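/- **Setting.** Let $\mu_n$ be the law of a Haar random pure state on $n$ qubits. A unital noise channel on $n$ qubits is a completely positive trace preserving map $\Gamma(\rho)=\sum_i E_i\rho E_i^\dagger$ with $\Gamma(I)=I$. An algorithm $W$ without quantum memory, with $T$ copies, measures $T$ copies of the unknown state one at a time, each by an arbitrary POVM that may depend on all previous outcomes, and then accepts or rejects depending on the outcomes; $W(\rho)$ denotes its acceptance probability on copies of $\rho$. It distinguishes two ensembles of states with advantage at least $\varepsilon$ if its average acceptance probabilities on the two ensembles (one state is drawn, all copies are of that state) differ by at least $\varepsilon$. A *quantum polynomial time* algorithm without quantum memory is a family of such algorithms (one for each $n$) with polynomially many copies and polynomially many bits of classical memory, in which the measurement in each round, the update of the classical memory, and the decision are performed by a polynomial time uniform family of quantum circuits acting on the current copy, the classical memory and fresh ancillas. A *memoryless PRS* is a keyed family of pure $n$-qubit states $\{|\phi_k\rangle\}_{k\in\{0,1\}^{\kappa(n)}}$, $\kappa$ a polynomial, that can be generated efficiently from the key and such that every quantum polynomial time algorithm without quantum memory distinguishes copies of $|\phi_k\rangle$ ($k$ uniform) from copies of a Haar random state with negligible advantage only. A family of channels is efficiently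 implementable if it is performed, up to a negligible error in trace distance, by a polynomial time uniform family of circuits with polynomially many ancillas. **Theorem.** 1. (Noisy Haar states, any unital noise, any memoryless adversary.) There is an absolute constant $c>0$ such that for all $n$, all unital channels $\Gamma$ on $n$ qubits and all $\varepsilon>0$, every algorithm without quantum memory that distinguishes $\Gamma(|\psi\rangle\langle\psi|)$, $\psi\sim\mu_n$, with advantage at least $\varepsilon$ from the maximally mixed state $I/2^n$, or from a (noiseless) Haar random state, uses at least $c\sqrt{\varepsilon}\,2^{n/2}$ copies. 2. (Pseudorandom families, any unital noise, any memoryless adversary.) There is an absolute constant $c>0$ such that the following holds for all $n$, $T$, all unital channels $\Gamma$ on $n$ qubits, all finite keyed families $\{|\phi_k\rangle\}_{k\in K}$ of pure $n$-qubit states and all $\delta$. If every algorithm without quantum memory that uses $T$ copies distinguishes $|\phi_k\rangle$ ($k$ uniform) from Haar random states with advantage at most $\delta$, and some algorithm without quantum memory that uses $T$ copies distinguishes the noisy states $\Gamma(|\phi_k\rangle\langle\phi_k|)$ from (noiseless) Haar random states with advantage at least $\delta+\varepsilon$, $\varepsilon>0$, then $T\ge c\sqrt{\varepsilon}\,2^{n/2}$.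 3. (Memoryless PRS, efficient unital noise, efficient memoryless adversary.) Let $\{|\phi_k\rangle\}_k$ be a memoryless PRS and $(\Gamma_n)_n$ an efficiently implementable family of unital channels. Then every quantum polynomial time algorithm without quantum memory distinguishes copies of $\Gamma_n(|\phi_k\rangle\langle\phi_k|)$ ($k$ uniform) from copies of a (noiseless) Haar random state with negligible advantage only; so superpolynomial resources are needed. -/

import Mathlib

open MeasureTheory
open scoped ComplexOrder

namespace MemorylessPRS

noncomputable section

/-! ### States, channels, Haar random states -/

/-- Operators on a register of qubits labelled by `Q`, written in the computational basis
`Q → Bool`. -/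
abbrev Op (Q : Type) : Type := Matrix (Q → Bool) (Q → Bool) ℂ

/-- Operators on `n` qubits. -/
abbrev QMat (n : ℕ) : Type := Op (Fin n)

/-- Unit vectors of the `n`-qubit space `ℂ^(2^n)`. -/
abbrev PureState (n : ℕ) : Type :=
  Metric.sphere (0 : EuclideanSpace ℂ (Fin n → Bool)) 1

/-- The density matrix `|ψ⟩⟨ψ|`. -/
def proj {n : ℕ} (ψ : PureState n) : QMat n :=
  fun x y => ψ.1 x * star (ψ.1 y)

/-- The maximally mixed state `I / 2^n`. -/
def maxMixed (n : ℕ) : QMat n := ((2 : ℂ) ^ n)⁻¹ • (1 : QMat n)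

/-- The law of a Haar random pure state: the rotation invariant probability measure on the unit
sphere (the normalised surface measure). -/
def haar (n : ℕ) : Measure (PureState n) :=
  ((volume : Measure (EuclideanSpace ℂ (Fin n → Bool))).toSphere Set.univ)⁻¹ •
    (volume : Measure (EuclideanSpace ℂ (Fin n → Bool))).toSphere

/-- Quantum channels (completely positive trace preserving maps) in Kraus form. -/
def IsChannel {n : ℕ} (Γ : QMat n → QMat n) : Prop :=
  ∃ (r : ℕ) (E : Fin r → QMat n), (∑ i, (E i).conjTranspose * E i = 1) ∧
    ∀ ρ, Γ ρ = ∑ i, E i * ρ * (E i).conjTranspose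

/-- Unital channels: the identity is a fixed point. -/
def IsUnitalChannel {n : ℕ} (Γ : QMat n → QMat n) : Prop :=
  IsChannel Γ ∧ Γ 1 = 1

/-- `A` and `B` (two density matrices) are at trace distance at most `ε`: no effect `0 ≤ E ≤ 1`
distinguishes them better than that. -/
def TraceClose {n : ℕ} (ε : ℝ) (A B : QMat n) : Prop :=
  ∀ E : QMat n, E.PosSemidef → (1 - E).PosSemidef → ‖(E * (A - B)).trace‖ ≤ ε

/-! ### Algorithms without quantum memory -/

/-- An algorithm without quantum memory on `n`-qubit states. It asks for `copies` copies of the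
unknown state, one at a time, and measures each of them by a POVM `povm h` that is chosen
depending on the list `h` of all the previous outcomes (the most recent one first); at the end it
accepts or rejects depending on the list of outcomes. All POVMs share one finite set of labels, of
arbitrary size (a POVM with fewer outcomes is padded by zero operators). -/
structure MemorylessAlgorithm (n : ℕ) where
  copies : ℕ
  Out : Type
  [fintypeOut : Fintype Out]
  povm : List Out → Out → QMat n
  posSemidef : ∀ h o, (povm h o).PosSemidef
  sum_eq_one : ∀ h, ∑ o, povm h o = 1
  accept : List Out → Bool

attribute [instance] MemorylessAlgorithm.fintypeOut

/-- Probability of acceptance when the outcomes `h` have been recorded and `t` copies of `ρ` are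
still to be measured. -/
def MemorylessAlgorithm.acceptFrom {n : ℕ} (W : MemorylessAlgorithm n) (ρ : QMat n) :
    ℕ → List W.Out → ℝ
  | 0, h => if W.accept h then 1 else 0
  | t + 1, h => ∑ o, ((W.povm h o * ρ).trace).re * W.acceptFrom ρ t (o :: h)

/-- Probability that `W` accepts when all its copies are in the state `ρ`. -/
def MemorylessAlgorithm.acceptProb {n : ℕ} (W : MemorylessAlgorithm n) (ρ : QMat n) : ℝ :=
  W.acceptFrom ρ W.copies []

/-- Probability that `W` accepts copies of `Γ (|ψ⟩⟨ψ|)`, for one Haar random `ψ`. -/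
def MemorylessAlgorithm.haarProb {n : ℕ} (W : MemorylessAlgorithm n) (Γ : QMat n → QMat n) : ℝ :=
  ∫ ψ, W.acceptProb (Γ (proj ψ)) ∂(haar n)

/-- Probability that `W` accepts copies of `Γ (|φ_k⟩⟨φ_k|)`, for one uniformly random key `k`. -/
def MemorylessAlgorithm.keyProb {n : ℕ} (W : MemorylessAlgorithm n) {K : Type} [Fintype K]
    (φ : K → PureState n) (Γ : QMat n → QMat n) : ℝ :=
  (Fintype.card K : ℝ)⁻¹ * ∑ k, W.acceptProb (Γ (proj (φ k)))

/-! ### Quantum circuits -/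

/-- Gates on qubits labelled by `Q`: Hadamard, `π/8` gate, controlled not (first argument:
control), and reset of a qubit to `|0⟩`. -/
inductive Gate (Q : Type) where
  | had (w : Q)
  | tee (w : Q)
  | cnot (c w : Q)
  | reset (w : Q)

/-- The single-qubit matrix `u` acting on qubit `w`. -/
def onQubit {Q : Type} [Fintype Q] [DecidableEq Q] (w : Q) (u : Matrix Bool Bool ℂ) : Op Q :=
  fun x y => if ∀ v, v ≠ w → x v = y v then u (x w) (y w) else 0

def hadMatrix : Matrix Bool Bool ℂ :=
  fun i j => ((Real.sqrt 2 : ℝ) : ℂ)⁻¹ * (if i && j then -1 else 1)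

def teeMatrix : Matrix Bool Bool ℂ :=
  fun i j => if i = j then
    (if i then Complex.exp (Complex.I * (Real.pi : ℂ) / 4) else 1) else 0

/-- `|0⟩⟨b|`. -/
def resetMatrix (b : Bool) : Matrix Bool Bool ℂ :=
  fun i j => if i = false ∧ j = b then 1 else 0

def cnotMatrix {Q : Type} [Fintype Q] [DecidableEq Q] (c w : Q) : Op Q :=
  fun x y => if x = Function.update y w (xor (y w) (y c)) then 1 else 0

/-- The action of a gate on density matrices. -/
def Gate.apply {Q : Type} [Fintype Q] [DecidableEq Q] : Gate Q → Op Q → Op Q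
  | .had w, ρ => onQubit w hadMatrix * ρ * (onQubit w hadMatrix).conjTranspose
  | .tee w, ρ => onQubit w teeMatrix * ρ * (onQubit w teeMatrix).conjTranspose
  | .cnot c w, ρ => cnotMatrix c w * ρ * (cnotMatrix c w).conjTranspose
  | .reset w, ρ =>
      ∑ b, onQubit w (resetMatrix b) * ρ * (onQubit w (resetMatrix b)).conjTranspose

/-- Names of qubits: the `i`-th qubit of the state register, of the register of classical bits,
or of the ancilla register. -/
inductive Wire where
  | state (i : ℕ)
  | bit (i : ℕ)
  | anc (i : ℕ)

/-- A register of `n` state qubits, `s` qubits that hold classical bits, and `a` ancillas. -/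
abbrev Reg (n s a : ℕ) : Type := Fin n ⊕ Fin s ⊕ Fin a

def Wire.locate (n s a : ℕ) : Wire → Option (Reg n s a)
  | .state i => if h : i < n then some (.inl ⟨i, h⟩) else none
  | .bit i => if h : i < s then some (.inr (.inl ⟨i, h⟩)) else none
  | .anc i => if h : i < a then some (.inr (.inr ⟨i, h⟩)) else none

def Gate.locate (n s a : ℕ) : Gate Wire → Option (Gate (Reg n s a))
  | .had w => (w.locate n s a).map Gate.had
  | .tee w => (w.locate n s a).map Gate.tee
  | .cnot c w => (c.locate n s a).bind fun c' => (w.locate n s a).map fun w' => Gate.cnot c' w'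
  | .reset w => (w.locate n s a).map Gate.reset

/-- Control and target of a controlled not have to differ. -/
def Gate.Proper {Q : Type} : Gate Q → Prop
  | .cnot c w => c ≠ w
  | _ => True

/-- A circuit is a list of gates, performed from left to right. -/
abbrev Circuit : Type := List (Gate Wire)

/-- All gates are proper and act on qubits that the register has. -/
def Circuit.Valid (C : Circuit) (n s a : ℕ) : Prop :=
  ∀ g ∈ C, g.Proper ∧ (g.locate n s a).isSome

def Circuit.run (C : Circuit) (n s a : ℕ) (ρ : Op (Reg n s a)) : Op (Reg n s a) :=
  (C.filterMap (Gate.locate n s a)).foldl (fun σ g => g.apply σ) ρ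

/-- `ρ ⊗ |m⟩⟨m| ⊗ |0⟩⟨0|`: state register `ρ`, classical bits `m`, ancillas zero. -/
def prepare {n s : ℕ} (a : ℕ) (ρ : QMat n) (m : Fin s → Bool) : Op (Reg n s a) :=
  fun x y =>
    if ((∀ i, x (.inr (.inl i)) = m i) ∧ (∀ i, x (.inr (.inr i)) = false)) ∧
       ((∀ i, y (.inr (.inl i)) = m i) ∧ (∀ i, y (.inr (.inr i)) = false))
    then ρ (fun i => x (.inl i)) (fun i => y (.inl i)) else 0

/-- Probability of reading `m` when the classical bits are measured in the computational basis. -/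
def readProb {n s a : ℕ} (σ : Op (Reg n s a)) (m : Fin s → Bool) : ℂ :=
  ∑ x : Reg n s a → Bool, if ∀ i, x (.inr (.inl i)) = m i then σ x x else 0

/-- The reduced state of the state register. -/
def reduce {n s a : ℕ} (σ : Op (Reg n s a)) : QMat n :=
  fun x y => ∑ z : Fin s ⊕ Fin a → Bool, σ (Sum.elim x z) (Sum.elim y z)

/-! ### Uniformity -/

/-- The alphabet in which circuits are written. -/
inductive Sym where
  | had | tee | cnot | reset | state | bit | anc | one

def Wire.encode : Wire → List Sym
  | .state i => List.replicate i .one ++ [.state]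
  | .bit i => List.replicate i .one ++ [.bit]
  | .anc i => List.replicate i .one ++ [.anc]

def Gate.encode : Gate Wire → List Sym
  | .had w => .had :: w.encode
  | .tee w => .tee :: w.encode
  | .cnot c w => .cnot :: (c.encode ++ w.encode)
  | .reset w => .reset :: w.encode

/-- Polynomial time uniform families of circuits: the description of the `n`-th circuit is
computed from `1^n` by a Turing machine in polynomial time. Closure under concatenation, which
the polynomial time computable functions have, is built in, since Mathlib has no composition
theorem for polynomial time Turing machines. -/
inductive Uniform : (ℕ → Circuit) → Prop
  | machine (C : ℕ → Circuit)
      (h : Nonempty (Turing.TM2ComputableInPolyTime (fun n : ℕ => List.replicate n ())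
        (fun D : Circuit => D.flatMap Gate.encode) C)) : Uniform C
  | append (C D : ℕ → Circuit) (hC : Uniform C) (hD : Uniform D) :
      Uniform (fun n => C n ++ D n)

/-! ### Efficient adversaries, efficient noise, memoryless PRS -/

/-- Negligible functions. -/
def Negligible (f : ℕ → ℝ) : Prop :=
  ∀ c : ℕ, ∃ n₀ : ℕ, ∀ n : ℕ, n₀ < n → f n < ((n : ℝ) ^ c)⁻¹

/-- Quantum polynomial time algorithms without quantum memory. The `n`-th algorithm uses `T(n)`
copies and has `s(n)` bits of classical memory, initially zero. In each round a circuit of a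
uniform polynomial time family acts on the fresh copy, the classical memory and `a(n)` fresh
ancillas in the state `|0⟩`; then the memory is measured in the computational basis, which gives
the new content of the memory, and all other qubits are discarded. After the last round the
algorithm accepts if and only if the memory bit with index zero is `1`.
As an algorithm without quantum memory, its outcome in each round is the new memory content. -/
def IsQPT (W : ∀ n, MemorylessAlgorithm n) : Prop :=
  ∃ (C : ℕ → Circuit) (T s a : Polynomial ℕ), Uniform C ∧
    (∀ n, (C n).Valid n (s.eval n) (a.eval n)) ∧
    ∀ n, (W n).copies = T.eval n ∧
      ∃ e : (W n).Out ≃ (Fin (s.eval n) → Bool),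
        let memory : List (W n).Out → (Fin (s.eval n) → Bool) :=
          fun h => (h.head?.map e).getD (fun _ => false)
        (∀ h o ρ, ((W n).povm h o * ρ).trace =
          readProb ((C n).run n (s.eval n) (a.eval n) (prepare (a.eval n) ρ (memory h))) (e o)) ∧
        (∀ h, (W n).accept h = true ↔ ∃ i, i.val = 0 ∧ memory h i = true)

/-- Efficiently implementable noise: up to a negligible error in trace distance, `Γ n` is performed
by circuits of a uniform polynomial time family with polynomially many ancillas. The ancillas
start in `|0⟩` and are returned in `|0⟩`, which is no restriction as they may be reset. -/
def IsEfficientNoise (Γ : ∀ n, QMat n → QMat n) : Prop :=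
  ∃ (C : ℕ → Circuit) (a : Polynomial ℕ) (Γ' : ∀ n, QMat n → QMat n) (ε : ℕ → ℝ),
    Uniform C ∧ (∀ n, (C n).Valid n 0 (a.eval n)) ∧ (∀ n, IsChannel (Γ' n)) ∧ Negligible ε ∧
    (∀ n ρ, (C n).run n 0 (a.eval n) (prepare (a.eval n) ρ Fin.elim0) =
      prepare (a.eval n) (Γ' n ρ) Fin.elim0) ∧
    ∀ n (ψ : PureState n), TraceClose (ε n) (Γ n (proj ψ)) (Γ' n (proj ψ))

/-- Memoryless pseudorandom states on `n` qubits with key space `{0,1}^κ(n)`: the states can be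
generated efficiently from the key (up to a negligible error in trace distance), and no quantum
polynomial time algorithm without quantum memory distinguishes copies of `|φ_k⟩`, for a uniformly
random key `k`, from copies of a Haar random state with more than negligible advantage. -/
structure IsMemorylessPRS (κ : Polynomial ℕ)
    (φ : ∀ n, (Fin (κ.eval n) → Bool) → PureState n) : Prop where
  efficient_generation : ∃ (C : ℕ → Circuit) (a : Polynomial ℕ) (ε : ℕ → ℝ),
    Uniform C ∧ (∀ n, (C n).Valid n (κ.eval n) (a.eval n)) ∧ Negligible ε ∧
    ∀ n k, TraceClose (ε n)
      (reduce ((C n).run n (κ.eval n) (a.eval n)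
        (prepare (a.eval n) (Matrix.single (fun _ => false) (fun _ => false) 1) k)))
      (proj (φ n k))
  indistinguishable : ∀ W : ∀ n, MemorylessAlgorithm n, IsQPT W →
    Negligible fun n => |(W n).keyProb (φ n) id - (W n).haarProb id|

end

end MemorylessPRS

open MemorylessPRS

/-!
Write `D = 2 ^ n`. Decompose every effect into rank one operators; then the likelihood of a record
of `t` measured copies of `ψ` is a sum of terms `‖f ψ‖ ^ 2`, where `f` is a product of `t` linear
forms, hence a homogeneous polynomial. Integration by parts along the unitary orbits shows
`‖c‖ ^ 2 * ∫ ‖f‖ ^ 2 ≤ (D + t) * ∫ ‖⟪c, ·⟫ * f‖ ^ 2` for such `f`. So the probability of every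
record of `T` copies of a Haar random state is at least `D ^ T / (D * (D + 1) * ⋯ * (D + T - 1))`
times, hence at least `1 - T ^ 2 / D` times, its probability for the maximally mixed state. Applied
to the algorithm and to the one with the opposite decision, this bounds the advantage by
`T ^ 2 / D`.

An algorithm without quantum memory can simulate noise by absorbing it into its measurements, and
unital noise fixes the maximally mixed state. So the same bound holds for noisy Haar random states,
and an adversary against noisy pseudorandom states yields one against the noiseless states. If the
noise is efficient, so is the simulation: run the noise circuit before each measurement.
-/

namespace MemorylessPRS

noncomputable section

open Metric ComplexConjugate
open scoped InnerProductSpace ContDiff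

/-! ### Unitarily invariant measures on spheres -/

section SphereMap

variable {𝕜 E : Type*} [NormedField 𝕜] [NormedAddCommGroup E] [NormedSpace 𝕜 E]

/-- The action of a linear isometry on the unit sphere. -/
def sphereMap (U : E ≃ₗᵢ[𝕜] E) (x : sphere (0 : E) 1) : sphere (0 : E) 1 :=
  ⟨U x, by simp⟩

theorem continuous_sphereMap (U : E ≃ₗᵢ[𝕜] E) : Continuous (sphereMap U) :=
  (U.continuous.comp continuous_subtype_val).subtype_mk _

theorem sphereMap_sphereMap_symm (U : E ≃ₗᵢ[𝕜] E) (x : sphere (0 : E) 1) :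
    sphereMap U (sphereMap U.symm x) = x :=
  Subtype.ext (U.apply_symm_apply x)

open scoped Pointwise in
theorem measurePreserving_sphereMap [NormedSpace ℝ E] [SMulCommClass ℝ 𝕜 E]
    [LinearMap.CompatibleSMul E E ℝ 𝕜] [MeasurableSpace E] [BorelSpace E] {μ : Measure E}
    {U : E ≃ₗᵢ[𝕜] E} (hU : MeasurePreserving U μ μ) :
    MeasurePreserving (sphereMap U) μ.toSphere μ.toSphere := by
  have hm := (continuous_sphereMap U).measurable
  have hsmul (r : ℝ) (x : E) : U (r • x) = r • U x :=
    LinearMap.map_smul_of_tower U.toLinearEquiv.toLinearMap r x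
  refine ⟨hm, Measure.ext fun s hs => ?_⟩
  have hcone : Set.Ioo (0 : ℝ) 1 • (Subtype.val '' (sphereMap U ⁻¹' s)) =
      U ⁻¹' (Set.Ioo (0 : ℝ) 1 • (Subtype.val '' s)) := by
    ext x
    simp only [Set.mem_smul, Set.mem_image, Set.mem_preimage]
    constructor
    · rintro ⟨r, hr, _, ⟨y, hy, rfl⟩, rfl⟩
      exact ⟨r, hr, _, ⟨_, hy, rfl⟩, (hsmul r y).symm⟩
    · rintro ⟨r, hr, _, ⟨y, hy, rfl⟩, hx⟩
      refine ⟨r, hr, _, ⟨sphereMap U.symm y, by rwa [sphereMap_sphereMap_symm], rfl⟩, ?_⟩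
      rw [← U.symm_apply_apply x, ← hx]
      exact U.injective (by simp [hsmul, sphereMap])
  rw [Measure.map_apply hm hs, μ.toSphere_apply' hs, μ.toSphere_apply' (hm hs), hcone,
    hU.measure_preimage_emb U.toHomeomorph.measurableEmbedding]

end SphereMap

/-- Measures on the unit sphere of a complex space that are invariant under all unitaries. Only
this property of the Haar measure enters the argument. -/
def IsUnitarilyInvariant {E : Type*} [NormedAddCommGroup E] [NormedSpace ℂ E] [MeasurableSpace E]
    (μ : Measure (sphere (0 : E) 1)) : Prop :=
  ∀ U : E ≃ₗᵢ[ℂ] E, MeasurePreserving (sphereMap U) μ μ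

instance isProbabilityMeasure_haar (n : ℕ) : IsProbabilityMeasure (haar n) := by
  have h : (volume : Measure (EuclideanSpace ℂ (Fin n → Bool))).toSphere ≠ 0 :=
    Measure.toSphere_ne_zero _
  constructor
  rw [haar, Measure.smul_apply, smul_eq_mul]
  exact ENNReal.inv_mul_cancel (mt Measure.measure_univ_eq_zero.1 h) (measure_ne_top _ _)

theorem isUnitarilyInvariant_haar (n : ℕ) : IsUnitarilyInvariant (haar n) := fun U =>
  (measurePreserving_sphereMap (LinearIsometryEquiv.measurePreserving
    ⟨U.toLinearEquiv.restrictScalars ℝ, U.norm_map⟩)).smul_measure _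

theorem integrable_of_continuous {X F : Type*} [TopologicalSpace X] [CompactSpace X]
    [MeasurableSpace X] [OpensMeasurableSpace X] {μ : Measure X} [IsFiniteMeasure μ]
    [NormedAddCommGroup F] {f : X → F} (hf : Continuous f) : Integrable f μ :=
  hf.integrable_of_hasCompactSupport (HasCompactSupport.of_compactSpace f)

section Infinitesimal

variable {E : Type*} [NormedAddCommGroup E] [InnerProductSpace ℂ E] [ProperSpace E]
  [MeasurableSpace E] [BorelSpace E] {μ : Measure (sphere (0 : E) 1)}

theorem IsUnitarilyInvariant.integral_exp_apply (hμ : IsUnitarilyInvariant μ) {K : E →L[ℂ] E}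
    (hK : K ∈ skewAdjoint (E →L[ℂ] E)) {F : E → ℂ} (hF : Continuous F) (θ : ℝ) :
    ∫ z, F (NormedSpace.exp (θ • K) z) ∂μ = ∫ z, F z ∂μ := by
  let _ : NormedAlgebra ℚ (E →L[ℂ] E) := .restrictScalars ℚ ℂ _
  have hu : NormedSpace.exp (θ • K) ∈ unitary (E →L[ℂ] E) :=
    NormedSpace.exp_mem_unitary_of_mem_skewAdjoint (skewAdjoint.smul_mem θ hK)
  have h := hμ (Unitary.linearIsometryEquiv ⟨_, hu⟩)
  conv_rhs => rw [← h.map_eq]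
  exact (integral_map h.measurable.aemeasurable
    (hF.comp continuous_subtype_val).aestronglyMeasurable).symm

variable [IsFiniteMeasure μ]

theorem IsUnitarilyInvariant.integral_fderiv_apply_eq_zero (hμ : IsUnitarilyInvariant μ)
    {K : E →L[ℂ] E} (hK : K ∈ skewAdjoint (E →L[ℂ] E)) {F : E → ℂ} (hF : ContDiff ℝ 1 F) :
    ∫ z, fderiv ℝ F z (K z) ∂μ = 0 := by
  -- Differentiate the constant function `θ ↦ ∫ F (exp (θ K) z)` at `θ = 0`.
  set U : ℝ → E →L[ℂ] E := fun θ => NormedSpace.exp (θ • K)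
  have hU (θ : ℝ) : HasDerivAt U (K * U θ) θ := hasDerivAt_exp_smul_const' (𝕂 := ℝ) K θ
  have hUc : Continuous fun a : ℝ × sphere (0 : E) 1 => U a.1 a.2 :=
    ((continuous_iff_continuousAt.2 fun θ => (hU θ).continuousAt).comp continuous_fst).clm_apply
      (continuous_subtype_val.comp continuous_snd)
  have hF' : Continuous fun a : ℝ × sphere (0 : E) 1 =>
      fderiv ℝ F (U a.1 a.2) (K (U a.1 a.2)) :=
    ((hF.continuous_fderiv one_ne_zero).comp hUc).clm_apply (K.continuous.comp hUc)
  have hderiv (z : E) (θ : ℝ) :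
      HasDerivAt (fun s => F (U s z)) (fderiv ℝ F (U θ z) (K (U θ z))) θ :=
    ((hF.differentiable one_ne_zero _).hasFDerivAt).comp_hasDerivAt θ
      (((ContinuousLinearMap.apply ℂ E z).restrictScalars ℝ).hasFDerivAt.comp_hasDerivAt θ (hU θ))
  obtain ⟨C, hC⟩ := ((isCompact_Icc (a := (-1 : ℝ)) (b := 1)).prod
    (isCompact_univ (X := sphere (0 : E) 1))).exists_bound_of_continuousOn hF'.continuousOn
  have h := (hasDerivAt_integral_of_dominated_loc_of_deriv_le (μ := μ) (bound := fun _ => C)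
    (F := fun θ z => F (U θ z)) (F' := fun θ z => fderiv ℝ F (U θ z) (K (U θ z)))
    (Icc_mem_nhds (a := (-1 : ℝ)) (b := 1) (x := 0) (by norm_num) (by norm_num))
    (.of_forall fun θ =>
      (hF.continuous.comp (hUc.comp (Continuous.prodMk_right θ))).aestronglyMeasurable)
    (integrable_of_continuous (hF.continuous.comp (hUc.comp (Continuous.prodMk_right 0))))
    (hF'.comp (Continuous.prodMk_right 0)).aestronglyMeasurable
    (ae_of_all _ fun z θ hθ => hC (θ, z) ⟨hθ, Set.mem_univ z⟩) (integrable_const C)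
    (ae_of_all _ fun z θ _ => hderiv z θ)).2
  simp only [U, hμ.integral_exp_apply hK hF.continuous, zero_smul, NormedSpace.exp_zero,
    one_apply_eq_self] at h
  exact h.unique (hasDerivAt_const _ _)

variable {f g : E → ℂ}

theorem integrable_fderiv_mul_conj (hf : ContDiff ℂ 1 f) (hg : Continuous g) (A : E →L[ℂ] E) :
    Integrable (fun z : sphere (0 : E) 1 => fderiv ℂ f z (A z) * conj (g z)) μ :=
  integrable_of_continuous <| by
    have := hf.continuous_fderiv one_ne_zero
    fun_prop

theorem integrable_mul_conj_fderiv (hf : Continuous f) (hg : ContDiff ℂ 1 g) (A : E →L[ℂ] E) :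
    Integrable (fun z : sphere (0 : E) 1 => f z * conj (fderiv ℂ g z (A z))) μ :=
  integrable_of_continuous <| by
    have := hg.continuous_fderiv one_ne_zero
    fun_prop

theorem IsUnitarilyInvariant.integral_fderiv_selfAdjoint (hμ : IsUnitarilyInvariant μ)
    (hf : ContDiff ℂ 1 f) (hg : ContDiff ℂ 1 g) {H : E →L[ℂ] E} (hH : IsSelfAdjoint H) :
    ∫ z, fderiv ℂ f z (H z) * conj (g z) ∂μ = ∫ z, f z * conj (fderiv ℂ g z (H z)) ∂μ := by
  have hK : Complex.I • H ∈ skewAdjoint (E →L[ℂ] E) := by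
    simp [skewAdjoint.mem_iff, hH.star_eq]
  have hfg (z : E) : fderiv ℝ (fun w => f w * conj (g w)) z ((Complex.I • H) z) =
      Complex.I * (fderiv ℂ f z (H z) * conj (g z) - f z * conj (fderiv ℂ g z (H z))) := by
    have h₁ := (hf.differentiable one_ne_zero z).hasFDerivAt.restrictScalars ℝ
    have h₂ := Complex.conjCLE.hasFDerivAt.comp z
      ((hg.differentiable one_ne_zero z).hasFDerivAt.restrictScalars ℝ)
    have h : fderiv ℝ (fun w => f w * conj (g w)) z = _ := (h₁.mul h₂).fderiv
    simp only [h, Function.comp_apply, Complex.conjCLE_apply, add_apply, smul_apply, smul_eq_mul,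
      ContinuousLinearMap.comp_apply, ContinuousLinearMap.coe_restrictScalars', map_smul,
      ContinuousLinearEquiv.coe_coe, map_mul, Complex.conj_I, neg_mul, mul_neg]
    ring
  have h := hμ.integral_fderiv_apply_eq_zero hK (F := fun w => f w * conj (g w))
    ((hf.restrict_scalars ℝ).mul (Complex.conjCLE.contDiff.comp (hg.restrict_scalars ℝ)))
  simp only [hfg, integral_const_mul] at h
  rw [integral_sub (integrable_fderiv_mul_conj hf hg.continuous H)
    (integrable_mul_conj_fderiv hf.continuous hg H)] at h
  exact sub_eq_zero.1 ((mul_eq_zero.1 h).resolve_left Complex.I_ne_zero)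

open scoped ComplexStarModule in
theorem IsUnitarilyInvariant.integral_fderiv_adjoint (hμ : IsUnitarilyInvariant μ)
    (hf : ContDiff ℂ 1 f) (hg : ContDiff ℂ 1 g) (A : E →L[ℂ] E) :
    ∫ z, fderiv ℂ f z (A z) * conj (g z) ∂μ = ∫ z, f z * conj (fderiv ℂ g z (star A z)) ∂μ := by
  have hstar : star A = (ℜ A : E →L[ℂ] E) - Complex.I • (ℑ A : E →L[ℂ] E) := by
    conv_lhs => rw [← realPart_add_I_smul_imaginaryPart A]
    simp [sub_eq_add_neg]
  calc ∫ z, fderiv ℂ f z (A z) * conj (g z) ∂μ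
      = ∫ z, (fderiv ℂ f z ((ℜ A : E →L[ℂ] E) z) * conj (g z) +
          Complex.I * (fderiv ℂ f z ((ℑ A : E →L[ℂ] E) z) * conj (g z))) ∂μ := by
        conv_lhs => rw [← realPart_add_I_smul_imaginaryPart A]
        simp [add_mul, mul_assoc]
    _ = ∫ z, (f z * conj (fderiv ℂ g z ((ℜ A : E →L[ℂ] E) z)) +
          Complex.I * (f z * conj (fderiv ℂ g z ((ℑ A : E →L[ℂ] E) z)))) ∂μ := by
        rw [integral_add, integral_add, integral_const_mul, integral_const_mul,
          hμ.integral_fderiv_selfAdjoint hf hg (ℜ A).2,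
          hμ.integral_fderiv_selfAdjoint hf hg (ℑ A).2]
        · exact integrable_mul_conj_fderiv hf.continuous hg _
        · exact (integrable_mul_conj_fderiv hf.continuous hg _).const_mul _
        · exact integrable_fderiv_mul_conj hf hg.continuous _
        · exact (integrable_fderiv_mul_conj hf hg.continuous _).const_mul _
    _ = ∫ z, f z * conj (fderiv ℂ g z (star A z)) ∂μ := by
        congr 1 with z
        simp only [hstar, sub_apply, smul_apply, map_sub, map_smul, smul_eq_mul, map_mul,
          Complex.conj_I, neg_mul, sub_neg_eq_add]
        ring

end Infinitesimal

/-! ### Homogeneous holomorphic functions -/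

theorem fderiv_inner_mul_apply {E : Type*} [NormedAddCommGroup E] [InnerProductSpace ℂ E]
    {f : E → ℂ} (hf : Differentiable ℂ f) (c z v : E) :
    fderiv ℂ (fun w => ⟪c, w⟫_ℂ * f w) z v = ⟪c, v⟫_ℂ * f z + ⟪c, z⟫_ℂ * fderiv ℂ f z v := by
  have h : fderiv ℂ (fun w => ⟪c, w⟫_ℂ * f w) z = _ :=
    ((innerSL ℂ c).hasFDerivAt.mul (hf z).hasFDerivAt).fderiv
  simp only [h, innerSL_apply_apply, add_apply, smul_apply, smul_eq_mul]
  ring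

/-- Holomorphic functions that are homogeneous of degree `t`, that is, homogeneous polynomials,
in a form that does not refer to coordinates. The amplitudes of the records of a measurement of
`t` copies of a pure state are such functions of the state. -/
structure IsHomogeneousHolomorphic {E : Type*} [NormedAddCommGroup E] [NormedSpace ℂ E] (t : ℕ)
    (f : E → ℂ) : Prop where
  contDiff : ContDiff ℂ ∞ f
  apply_smul : ∀ (a : ℂ) z, f (a • z) = a ^ t * f z

namespace IsHomogeneousHolomorphic

section NormedSpace

variable {E : Type*} [NormedAddCommGroup E] [NormedSpace ℂ E] {t : ℕ} {f : E → ℂ}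

theorem const (a : ℂ) : IsHomogeneousHolomorphic 0 fun _ : E => a :=
  ⟨contDiff_const, by simp⟩

theorem differentiable (hf : IsHomogeneousHolomorphic t f) : Differentiable ℂ f :=
  hf.contDiff.differentiable (by simp)

theorem clm_mul (hf : IsHomogeneousHolomorphic t f) (L : E →L[ℂ] ℂ) :
    IsHomogeneousHolomorphic (t + 1) fun z => L z * f z :=
  ⟨L.contDiff.mul hf.contDiff, fun a z => by
    rw [map_smul, smul_eq_mul, hf.apply_smul]
    ring⟩

theorem fderiv_self (hf : IsHomogeneousHolomorphic t f) (z : E) :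
    fderiv ℂ f z z = t * f z := by
  have h₁ : HasDerivAt (fun a : ℂ => f (a • z)) (fderiv ℂ f z z) 1 := by
    simpa [Function.comp_def] using
      ((hf.differentiable ((1 : ℂ) • z)).hasFDerivAt).comp_hasDerivAt 1
        ((hasDerivAt_id (1 : ℂ)).smul_const z)
  have h₂ : HasDerivAt (fun a : ℂ => f (a • z)) (t * f z) 1 := by
    simpa only [hf.apply_smul, one_pow, mul_one] using (hasDerivAt_pow t (1 : ℂ)).mul_const (f z)
  exact h₁.unique h₂

theorem fderiv_smul_apply (hf : IsHomogeneousHolomorphic t f) (a : ℂ) (z c : E) :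
    a * fderiv ℂ f (a • z) c = a ^ t * fderiv ℂ f z c := by
  have h₁ : fderiv ℂ (fun w => f (a • w)) z = a • fderiv ℂ f (a • z) :=
    fderiv_comp_smul ..
  have h₂ : fderiv ℂ (fun w => f (a • w)) z = a ^ t • fderiv ℂ f z := by
    simp only [hf.apply_smul, fderiv_const_mul (hf.differentiable z)]
  simpa using congrArg (fun L => L c) (h₁.symm.trans h₂)

theorem fderiv_apply (hf : IsHomogeneousHolomorphic (t + 1) f) (c : E) :
    IsHomogeneousHolomorphic t fun z => fderiv ℂ f z c := by
  have hd : ContDiff ℂ ∞ fun z => fderiv ℂ f z c :=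
    (hf.contDiff.fderiv_right (by simp)).clm_apply contDiff_const
  refine ⟨hd, fun a z => ?_⟩
  have hc₁ : Continuous fun b : ℂ => fderiv ℂ f (b • z) c :=
    hd.continuous.comp (continuous_id.smul continuous_const)
  have hc₂ : Continuous fun b : ℂ => b ^ t * fderiv ℂ f z c := by fun_prop
  refine congrFun (hc₁.ext_on (dense_compl_singleton 0) hc₂ fun b (hb : b ≠ 0) => ?_) a
  refine mul_left_cancel₀ hb ?_
  rw [hf.fderiv_smul_apply, pow_succ']
  ring

theorem fderiv_eq_zero (hf : IsHomogeneousHolomorphic 0 f) (z : E) : fderiv ℂ f z = 0 := by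
  have h (w : E) : f w = f 0 := by simpa using (hf.apply_smul 0 w).symm
  rw [funext h, fderiv_fun_const, Pi.zero_apply]

end NormedSpace

theorem sum_fderiv_inner_mul_apply {E ι : Type*} [NormedAddCommGroup E] [InnerProductSpace ℂ E]
    [Fintype ι] {f : E → ℂ} {t : ℕ} (hf : IsHomogeneousHolomorphic t f)
    (e : OrthonormalBasis ι ℂ E) (c z : E) :
    ∑ j, fderiv ℂ (fun w => ⟪e j, w⟫_ℂ * f w) z (⟪c, z⟫_ℂ • e j) =
      (Fintype.card ι + t) * (⟪c, z⟫_ℂ * f z) := by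
  have hj (j) : fderiv ℂ (fun w => ⟪e j, w⟫_ℂ * f w) z (⟪c, z⟫_ℂ • e j) =
      ⟪c, z⟫_ℂ * (f z + fderiv ℂ f z (⟪e j, z⟫_ℂ • e j)) := by
    rw [fderiv_inner_mul_apply hf.differentiable, inner_smul_right, map_smul, map_smul,
      inner_self_eq_norm_sq_to_K, e.norm_eq_one, smul_eq_mul, smul_eq_mul]
    push_cast
    ring
  simp only [hj]
  rw [← Finset.mul_sum, Finset.sum_add_distrib, ← map_sum, e.sum_repr', hf.fderiv_self,
    Finset.sum_const, Finset.card_univ, nsmul_eq_mul]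
  ring

section InnerProductSpace

variable {E : Type*} [NormedAddCommGroup E] [InnerProductSpace ℂ E] [ProperSpace E]
  [MeasurableSpace E] [BorelSpace E] {μ : Measure (sphere (0 : E) 1)} [IsFiniteMeasure μ]
  {t : ℕ} {f : E → ℂ}

theorem integral_inner_mul (hf : IsHomogeneousHolomorphic t f) (hμ : IsUnitarilyInvariant μ)
    {g : E → ℂ} (hg : ContDiff ℂ 1 g) (c : E) :
    (Module.finrank ℂ E + t) * ∫ z : sphere (0 : E) 1, ⟪c, (z : E)⟫_ℂ * f z * conj (g z) ∂μ =
      ∫ z, f z * conj (fderiv ℂ g z c) ∂μ := by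
  have := FiniteDimensional.of_locallyCompactSpace ℂ (E := E)
  set e := stdOrthonormalBasis ℂ E
  -- Sum the adjointness relations of the operators `z ↦ ⟪c, z⟫ • e j`, whose adjoints are
  -- `z ↦ ⟪e j, z⟫ • c`, over the basis.
  have hfj (j) : ContDiff ℂ 1 fun z => ⟪e j, z⟫_ℂ * f z :=
    (hf.clm_mul (innerSL ℂ (e j))).contDiff.of_le (by simp)
  have hadj (j) := hμ.integral_fderiv_adjoint (hfj j) hg (InnerProductSpace.rankOne ℂ (e j) c)
  simp only [ContinuousLinearMap.star_eq_adjoint, InnerProductSpace.adjoint_rankOne,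
    InnerProductSpace.rankOne_apply] at hadj
  have hl (z : E) : ∑ j, fderiv ℂ (fun z => ⟪e j, z⟫_ℂ * f z) z (⟪c, z⟫_ℂ • e j) * conj (g z) =
      (Module.finrank ℂ E + t) * (⟪c, z⟫_ℂ * f z * conj (g z)) := by
    rw [← Finset.sum_mul, hf.sum_fderiv_inner_mul_apply, Fintype.card_fin, mul_assoc]
  have hr (z : sphere (0 : E) 1) :
      ∑ j, ⟪e j, (z : E)⟫_ℂ * f z * conj (fderiv ℂ g z (⟪e j, (z : E)⟫_ℂ • c)) =
        f z * conj (fderiv ℂ g z c) := by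
    have hz : ∑ j, ⟪e j, (z : E)⟫_ℂ * conj ⟪e j, (z : E)⟫_ℂ = 1 := by
      simp only [inner_conj_symm, mul_comm ⟪e _, (z : E)⟫_ℂ, e.sum_inner_mul_inner,
        inner_self_eq_norm_sq_to_K, norm_eq_of_mem_sphere z]
      simp
    calc _ = (∑ j, ⟪e j, (z : E)⟫_ℂ * conj ⟪e j, (z : E)⟫_ℂ) * (f z * conj (fderiv ℂ g z c)) := by
          rw [Finset.sum_mul]
          refine Finset.sum_congr rfl fun j _ => ?_
          rw [map_smul, smul_eq_mul, map_mul]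
          ring
      _ = f z * conj (fderiv ℂ g z c) := by rw [hz, one_mul]
  rw [← integral_const_mul]
  simp only [← hl, ← hr]
  rw [integral_finsetSum _ fun j _ => ?_, integral_finsetSum _ fun j _ => ?_]
  · exact Finset.sum_congr rfl fun j _ => hadj j
  · exact integrable_mul_conj_fderiv (hfj j).continuous hg (InnerProductSpace.rankOne ℂ c (e j))
  · exact integrable_fderiv_mul_conj (hfj j) hg.continuous (InnerProductSpace.rankOne ℂ (e j) c)

theorem integral_inner_mul_fderiv_nonneg [Nontrivial E] (hf : IsHomogeneousHolomorphic t f)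
    (hμ : IsUnitarilyInvariant μ) (c : E) :
    0 ≤ ∫ z : sphere (0 : E) 1, ⟪c, (z : E)⟫_ℂ * fderiv ℂ f z c * conj (f z) ∂μ := by
  cases t with
  | zero => simp [hf.fderiv_eq_zero]
  | succ t =>
    have hpos : (0 : ℂ) < Module.finrank ℂ E + t := by
      have := FiniteDimensional.of_locallyCompactSpace ℂ (E := E)
      exact_mod_cast Nat.add_pos_left Module.finrank_pos t
    rw [(eq_inv_mul_iff_mul_eq₀ hpos.ne').2
      ((hf.fderiv_apply c).integral_inner_mul hμ (hf.contDiff.of_le (by simp)) c)]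
    exact mul_nonneg (RCLike.inv_pos_of_pos hpos).le
      (integral_nonneg fun z => mul_star_self_nonneg _)

theorem norm_sq_mul_integral_norm_sq_le [Nontrivial E] (hf : IsHomogeneousHolomorphic t f)
    (hμ : IsUnitarilyInvariant μ) (c : E) :
    ‖c‖ ^ 2 * ∫ z : sphere (0 : E) 1, ‖f z‖ ^ 2 ∂μ ≤
      (Module.finrank ℂ E + t) * ∫ z : sphere (0 : E) 1, ‖⟪c, (z : E)⟫_ℂ * f z‖ ^ 2 ∂μ := by
  have hcf : ContDiff ℂ 1 fun z => ⟪c, z⟫_ℂ * f z :=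
    (hf.clm_mul (innerSL ℂ c)).contDiff.of_le (by simp)
  have hf₁ : ContDiff ℂ 1 f := hf.contDiff.of_le (by simp)
  have : Continuous fun z => fderiv ℂ f z c :=
    (hf₁.continuous_fderiv one_ne_zero).clm_apply continuous_const
  have hfc := hf₁.continuous
  have hexpand (z : sphere (0 : E) 1) : f z * conj (fderiv ℂ (fun w => ⟪c, w⟫_ℂ * f w) z c) =
      ((‖c‖ ^ 2 * ‖f z‖ ^ 2 : ℝ) : ℂ) + conj (⟪c, (z : E)⟫_ℂ * fderiv ℂ f z c * conj (f z)) := by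
    rw [fderiv_inner_mul_apply hf.differentiable, inner_self_eq_norm_sq_to_K]
    push_cast
    rw [← Complex.mul_conj' (f z)]
    simp only [map_add, map_mul, map_pow, Complex.coe_algebraMap, Complex.conj_ofReal,
      RingHomCompTriple.comp_apply, RingHom.id_apply]
    ring
  have key := hf.integral_inner_mul hμ hcf c
  simp only [hexpand, Complex.mul_conj', ← Complex.ofReal_pow] at key
  rw [integral_add (integrable_of_continuous (by fun_prop))
    (integrable_of_continuous (by fun_prop)), integral_conj, integral_complex_ofReal,
    integral_complex_ofReal, integral_const_mul] at key
  have hle := le_add_of_nonneg_right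
    (a := ((‖c‖ ^ 2 * ∫ z : sphere (0 : E) 1, ‖f z‖ ^ 2 ∂μ : ℝ) : ℂ))
    (star_nonneg_iff.2 (hf.integral_inner_mul_fderiv_nonneg hμ c))
  exact_mod_cast hle.trans_eq key.symm

end InnerProductSpace

end IsHomogeneousHolomorphic

/-! ### Density matrices -/

/-- Density matrices: positive semidefinite matrices of trace one. -/
structure IsDensityMatrix {ι : Type*} [Fintype ι] (ρ : Matrix ι ι ℂ) : Prop where
  posSemidef : ρ.PosSemidef
  trace_eq_one : ρ.trace = 1

theorem trace_mul_nonneg {ι : Type*} [Fintype ι] {M ρ : Matrix ι ι ℂ} (hM : M.PosSemidef)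
    (hρ : ρ.PosSemidef) : 0 ≤ (M * ρ).trace := by
  obtain ⟨m, v, rfl⟩ := Matrix.posSemidef_iff_eq_sum_vecMulVec.1 hM
  rw [Finset.sum_mul, Matrix.trace_sum]
  refine Finset.sum_nonneg fun i _ => ?_
  rw [Matrix.trace_mul_comm, Matrix.mul_vecMulVec, Matrix.trace_vecMulVec, dotProduct_comm]
  exact hρ.dotProduct_mulVec_nonneg (v i)

theorem re_trace_mul_nonneg {ι : Type*} [Fintype ι] {M ρ : Matrix ι ι ℂ} (hM : M.PosSemidef)
    (hρ : ρ.PosSemidef) : 0 ≤ (M * ρ).trace.re :=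
  (Complex.nonneg_iff.1 (trace_mul_nonneg hM hρ)).1

section States

variable {n : ℕ}

theorem proj_eq_vecMulVec (ψ : PureState n) : proj ψ = Matrix.vecMulVec ψ.1 (star ψ.1) := rfl

theorem continuous_proj : Continuous (proj : PureState n → QMat n) :=
  continuous_pi fun x => continuous_pi fun y => by unfold proj; fun_prop

theorem isDensityMatrix_proj (ψ : PureState n) : IsDensityMatrix (proj ψ) where
  posSemidef := Matrix.posSemidef_vecMulVec_self_star _
  trace_eq_one := by
    rw [proj_eq_vecMulVec, Matrix.trace_vecMulVec, ← EuclideanSpace.inner_eq_star_dotProduct,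
      inner_self_eq_norm_sq_to_K, norm_eq_of_mem_sphere]
    simp

theorem isDensityMatrix_maxMixed (n : ℕ) : IsDensityMatrix (maxMixed n) where
  posSemidef := Matrix.PosSemidef.one.smul (by positivity)
  trace_eq_one := by simp [maxMixed]

theorem re_trace_mul_maxMixed (M : QMat n) :
    (M * maxMixed n).trace.re = M.trace.re / 2 ^ n := by
  have h : (2 : ℂ) ^ n = ((2 ^ n : ℝ) : ℂ) := by push_cast; rfl
  rw [maxMixed, Matrix.mul_smul, mul_one, Matrix.trace_smul, smul_eq_mul, mul_comm,
    ← div_eq_mul_inv, h, Complex.div_ofReal_re]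

theorem exists_re_trace_mul_proj_eq_sum {M : QMat n} (hM : M.PosSemidef) :
    ∃ (m : ℕ) (c : Fin m → EuclideanSpace ℂ (Fin n → Bool)),
      M.trace.re = ∑ i, ‖c i‖ ^ 2 ∧
      ∀ ψ : PureState n, (M * proj ψ).trace.re = ∑ i, ‖⟪c i, ψ.1⟫_ℂ‖ ^ 2 := by
  obtain ⟨m, v, rfl⟩ := Matrix.posSemidef_iff_eq_sum_vecMulVec.1 hM
  refine ⟨m, fun i => WithLp.toLp 2 (v i), ?_, fun ψ => ?_⟩
  · rw [Matrix.trace_sum, Complex.re_sum]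
    refine Finset.sum_congr rfl fun i _ => ?_
    have hnorm : dotProduct (v i) (star (v i)) = ((‖WithLp.toLp 2 (v i)‖ ^ 2 : ℝ) : ℂ) := by
      rw [← EuclideanSpace.inner_toLp_toLp, inner_self_eq_norm_sq_to_K]
      norm_cast
    rw [Matrix.trace_vecMulVec, hnorm, Complex.ofReal_re]
  · rw [Finset.sum_mul, Matrix.trace_sum, Complex.re_sum]
    refine Finset.sum_congr rfl fun i _ => ?_
    have hinner : dotProduct (star (v i)) ψ.1 = ⟪WithLp.toLp 2 (v i), ψ.1⟫_ℂ := by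
      rw [EuclideanSpace.inner_eq_star_dotProduct, dotProduct_comm]
    have hstar : dotProduct (v i) (star ψ.1.ofLp) = conj ⟪WithLp.toLp 2 (v i), ψ.1⟫_ℂ := by
      rw [inner_conj_symm, EuclideanSpace.inner_eq_star_dotProduct]
    rw [proj_eq_vecMulVec, Matrix.vecMulVec_mul_vecMulVec, Matrix.trace_vecMulVec,
      dotProduct_smul, hinner, hstar, smul_eq_mul, Complex.mul_conj,
      Complex.ofReal_re, Complex.normSq_eq_norm_sq]

end States

/-! ### Haar random states and the maximally mixed state -/

namespace MemorylessAlgorithm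

variable {n : ℕ} (W : MemorylessAlgorithm n)

theorem continuous_acceptFrom (t : ℕ) (h : List W.Out) :
    Continuous fun ρ : QMat n => W.acceptFrom ρ t h := by
  induction t generalizing h with
  | zero => exact continuous_const
  | succ t ih =>
    exact continuous_finsetSum _ fun o _ => (Complex.continuous_re.comp
      (continuous_const.matrix_mul continuous_id).matrix_trace).mul (ih _)

theorem sum_re_trace_povm_mul (h : List W.Out) {ρ : QMat n} (hρ : ρ.trace = 1) :
    ∑ o, (W.povm h o * ρ).trace.re = 1 := by
  rw [← Complex.re_sum, ← Matrix.trace_sum, ← Finset.sum_mul, W.sum_eq_one, one_mul, hρ,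
    Complex.one_re]

theorem acceptFrom_mem_Icc {ρ : QMat n} (hρ : IsDensityMatrix ρ) (t : ℕ) (h : List W.Out) :
    W.acceptFrom ρ t h ∈ Set.Icc (0 : ℝ) 1 := by
  induction t generalizing h with
  | zero => unfold acceptFrom; split_ifs <;> simp
  | succ t ih =>
    have hp (o) : 0 ≤ (W.povm h o * ρ).trace.re :=
      re_trace_mul_nonneg (W.posSemidef h o) hρ.posSemidef
    refine ⟨Finset.sum_nonneg fun o _ => mul_nonneg (hp o) (ih _).1, ?_⟩
    calc W.acceptFrom ρ (t + 1) h ≤ ∑ o, (W.povm h o * ρ).trace.re :=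
          Finset.sum_le_sum fun o _ => mul_le_of_le_one_right (hp o) (ih _).2
      _ = 1 := W.sum_re_trace_povm_mul h hρ.trace_eq_one

end MemorylessAlgorithm

section HaarVersusMixed

variable {n : ℕ}

/-- One round of the comparison, for the outcome with effect `M`: `a` and `b * G ψ` stand for the
acceptance probabilities of the later rounds. -/
theorem mul_trace_mul_integral_le {s : ℕ} {a b : ℝ} (ha : 0 ≤ a) {G : PureState n → ℝ}
    (hG : Continuous G)
    (hab : ∀ g : EuclideanSpace ℂ (Fin n → Bool) → ℂ, IsHomogeneousHolomorphic (s + 1) g →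
      a * ∫ ψ : PureState n, ‖g ψ‖ ^ 2 ∂(haar n) ≤ b * ∫ ψ, ‖g ψ‖ ^ 2 * G ψ ∂(haar n))
    {M : QMat n} (hM : M.PosSemidef) {f : EuclideanSpace ℂ (Fin n → Bool) → ℂ}
    (hf : IsHomogeneousHolomorphic s f) :
    a * (M.trace.re * ∫ ψ : PureState n, ‖f ψ‖ ^ 2 ∂(haar n)) ≤
      (2 ^ n + s) * (b * ∫ ψ, ‖f ψ‖ ^ 2 * ((M * proj ψ).trace.re * G ψ) ∂(haar n)) := by
  obtain ⟨m, c, hc, hψ⟩ := exists_re_trace_mul_proj_eq_sum hM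
  have hfc := hf.contDiff.continuous
  have hsum : ∫ ψ : PureState n, ‖f ψ‖ ^ 2 * ((M * proj ψ).trace.re * G ψ) ∂(haar n) =
      ∑ i, ∫ ψ : PureState n, ‖⟪c i, ψ.1⟫_ℂ * f ψ‖ ^ 2 * G ψ ∂(haar n) := by
    rw [← integral_finsetSum _ fun i _ => integrable_of_continuous (by fun_prop)]
    congr 1 with ψ
    simp only [hψ, Finset.sum_mul, Finset.mul_sum, norm_mul, mul_pow]
    exact Finset.sum_congr rfl fun i _ => by ring
  rw [hsum, hc, Finset.sum_mul, Finset.mul_sum, Finset.mul_sum, Finset.mul_sum]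
  refine Finset.sum_le_sum fun i _ => ?_
  have hle := hf.norm_sq_mul_integral_norm_sq_le (isUnitarilyInvariant_haar n) (c i)
  have hab' := hab _ (hf.clm_mul (innerSL ℂ (c i)))
  have hdim : Module.finrank ℂ (EuclideanSpace ℂ (Fin n → Bool)) = 2 ^ n := by simp
  rw [hdim] at hle
  push_cast at hle
  calc a * (‖c i‖ ^ 2 * ∫ ψ : PureState n, ‖f ψ‖ ^ 2 ∂(haar n))
      ≤ a * ((2 ^ n + s) * ∫ ψ : PureState n, ‖⟪c i, ψ.1⟫_ℂ * f ψ‖ ^ 2 ∂(haar n)) :=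
        mul_le_mul_of_nonneg_left hle ha
    _ = (2 ^ n + s) * (a * ∫ ψ : PureState n, ‖⟪c i, ψ.1⟫_ℂ * f ψ‖ ^ 2 ∂(haar n)) := by ring
    _ ≤ _ := mul_le_mul_of_nonneg_left hab' (by positivity)

/-- The likelihood of the outcomes that led to the history `h` is a sum of terms `‖f ψ‖ ^ 2`. -/
theorem MemorylessAlgorithm.pow_mul_acceptFrom_maxMixed_le (W : MemorylessAlgorithm n) (t s : ℕ)
    (h : List W.Out) {f : EuclideanSpace ℂ (Fin n → Bool) → ℂ}
    (hf : IsHomogeneousHolomorphic s f) :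
    (2 ^ n) ^ t * W.acceptFrom (maxMixed n) t h * ∫ ψ : PureState n, ‖f ψ‖ ^ 2 ∂(haar n) ≤
      (2 ^ n + s).ascFactorial t *
        ∫ ψ : PureState n, ‖f ψ‖ ^ 2 * W.acceptFrom (proj ψ) t h ∂(haar n) := by
  induction t generalizing s h f with
  | zero =>
    simp only [acceptFrom, integral_mul_const, pow_zero, one_mul, Nat.ascFactorial_zero,
      Nat.cast_one]
    rw [mul_comm]
  | succ t ih =>
    have hfc := hf.contDiff.continuous
    have hG (o) : Continuous fun ψ : PureState n => W.acceptFrom (proj ψ) t (o :: h) :=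
      (W.continuous_acceptFrom t _).comp continuous_proj
    have hM (o) : Continuous fun ψ : PureState n => (W.povm h o * proj ψ).trace.re :=
      Complex.continuous_re.comp (continuous_const.matrix_mul continuous_proj).matrix_trace
    have hround (o) := mul_trace_mul_integral_le
      (mul_nonneg (by positivity) (W.acceptFrom_mem_Icc (isDensityMatrix_maxMixed n) t (o :: h)).1)
      (hG o) (fun g hg => ih (s + 1) (o :: h) hg) (W.posSemidef h o) hf
    have hasc : ((2 ^ n + s).ascFactorial (t + 1) : ℝ) =
        (2 ^ n + s) * (2 ^ n + (s + 1)).ascFactorial t := by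
      exact_mod_cast (Nat.succ_ascFactorial (2 ^ n + s) t).symm
    have hmixed : W.acceptFrom (maxMixed n) (t + 1) h =
        (∑ o, (W.povm h o).trace.re * W.acceptFrom (maxMixed n) t (o :: h)) / 2 ^ n := by
      simp only [acceptFrom, re_trace_mul_maxMixed, Finset.sum_div, div_mul_eq_mul_div]
    have hhaar : ∫ ψ : PureState n, ‖f ψ‖ ^ 2 * W.acceptFrom (proj ψ) (t + 1) h ∂(haar n) =
        ∑ o, ∫ ψ : PureState n,
          ‖f ψ‖ ^ 2 * ((W.povm h o * proj ψ).trace.re * W.acceptFrom (proj ψ) t (o :: h))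
            ∂(haar n) := by
      rw [← integral_finsetSum _ fun o _ => integrable_of_continuous (by fun_prop)]
      simp only [acceptFrom, Finset.mul_sum]
    rw [hasc, hmixed, hhaar]
    calc (2 ^ n) ^ (t + 1) * ((∑ o, (W.povm h o).trace.re *
            W.acceptFrom (maxMixed n) t (o :: h)) / 2 ^ n) * ∫ ψ : PureState n, ‖f ψ‖ ^ 2 ∂(haar n)
        = ∑ o, (2 ^ n) ^ t * W.acceptFrom (maxMixed n) t (o :: h) *
            ((W.povm h o).trace.re * ∫ ψ : PureState n, ‖f ψ‖ ^ 2 ∂(haar n)) := by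
          rw [pow_succ, mul_assoc _ ((2 : ℝ) ^ n), mul_div_cancel₀ _ (by positivity),
            Finset.mul_sum, Finset.sum_mul]
          exact Finset.sum_congr rfl fun o _ => by ring
      _ ≤ _ := Finset.sum_le_sum fun o _ => hround o
      _ = _ := by rw [Finset.mul_sum]; simp only [mul_assoc]

theorem one_sub_sq_div_mul_ascFactorial_le {D : ℕ} (hD : 0 < D) (k : ℕ) :
    (1 - (k : ℝ) ^ 2 / D) * (D.ascFactorial k : ℝ) ≤ (D : ℝ) ^ k := by
  induction k with
  | zero => simp
  | succ k ih =>
    have hstep : (1 - ((k + 1 : ℕ) : ℝ) ^ 2 / D) * (D + k) ≤ D * (1 - (k : ℝ) ^ 2 / D) := by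
      have hdiff : D * (1 - (k : ℝ) ^ 2 / D) - (1 - ((k + 1 : ℕ) : ℝ) ^ 2 / D) * (D + k) =
          k + 1 + k * (k + 1) ^ 2 / D := by
        push_cast
        field_simp
        ring
      exact sub_nonneg.1 (hdiff ▸ by positivity)
    calc (1 - ((k + 1 : ℕ) : ℝ) ^ 2 / D) * (D.ascFactorial (k + 1) : ℝ)
        = (1 - ((k + 1 : ℕ) : ℝ) ^ 2 / D) * (D + k) * (D.ascFactorial k : ℝ) := by
          rw [Nat.ascFactorial_succ, Nat.cast_mul, Nat.cast_add D, mul_assoc]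
      _ ≤ D * (1 - (k : ℝ) ^ 2 / D) * (D.ascFactorial k : ℝ) := by gcongr
      _ = D * ((1 - (k : ℝ) ^ 2 / D) * (D.ascFactorial k : ℝ)) := mul_assoc _ _ _
      _ ≤ D * (D : ℝ) ^ k := by gcongr
      _ = (D : ℝ) ^ (k + 1) := (pow_succ' _ _).symm

end HaarVersusMixed

namespace MemorylessAlgorithm

variable {n : ℕ} (W : MemorylessAlgorithm n)

theorem acceptProb_maxMixed_sub_le_haarProb_id :
    W.acceptProb (maxMixed n) - (W.copies : ℝ) ^ 2 / 2 ^ n ≤ W.haarProb id := by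
  have key : (2 ^ n) ^ W.copies * W.acceptProb (maxMixed n) ≤
      (2 ^ n).ascFactorial W.copies * W.haarProb id := by
    simpa [acceptProb, haarProb] using W.pow_mul_acceptFrom_maxMixed_le W.copies 0 [] (.const 1)
  have hpos : (0 : ℝ) < (2 ^ n).ascFactorial W.copies := by
    exact_mod_cast (pow_pos (pow_pos two_pos n) _).trans_le
      (Nat.pow_succ_le_ascFactorial (2 ^ n) W.copies)
  obtain ⟨h₀, h₁⟩ := W.acceptFrom_mem_Icc (isDensityMatrix_maxMixed n) W.copies []
  have hbirthday := one_sub_sq_div_mul_ascFactorial_le (D := 2 ^ n) (by positivity) W.copies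
  push_cast at hbirthday
  have hratio : (1 - (W.copies : ℝ) ^ 2 / 2 ^ n) * W.acceptProb (maxMixed n) ≤ W.haarProb id := by
    refine le_of_mul_le_mul_left (le_trans ?_ key) hpos
    rw [← mul_assoc]
    exact mul_le_mul_of_nonneg_right ((mul_comm _ _).trans_le hbirthday) h₀
  refine le_trans ?_ hratio
  rw [one_sub_mul]
  exact sub_le_sub_left (mul_le_of_le_one_right (by positivity) h₁) _

/-- The algorithm with the opposite decision. -/
def compl : MemorylessAlgorithm n :=
  { W with accept := fun h => !W.accept h }

theorem acceptFrom_compl {ρ : QMat n} (hρ : ρ.trace = 1) (t : ℕ) (h : List W.Out) :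
    W.compl.acceptFrom ρ t h = 1 - W.acceptFrom ρ t h := by
  induction t generalizing h with
  | zero => cases hacc : W.accept h <;> simp [acceptFrom, compl, hacc]
  | succ t ih =>
    calc W.compl.acceptFrom ρ (t + 1) h
        = ∑ o, (W.povm h o * ρ).trace.re * W.compl.acceptFrom ρ t (o :: h) := rfl
      _ = ∑ o, (W.povm h o * ρ).trace.re * (1 - W.acceptFrom ρ t (o :: h)) :=
          Finset.sum_congr rfl fun o _ => congrArg _ (ih (o :: h))
      _ = 1 - W.acceptFrom ρ (t + 1) h := by
          simp only [mul_one_sub, Finset.sum_sub_distrib, W.sum_re_trace_povm_mul h hρ]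
          rfl

theorem integrable_acceptProb {Γ : QMat n → QMat n} (hΓ : Continuous Γ) :
    Integrable (fun ψ => W.acceptProb (Γ (proj ψ))) (haar n) :=
  integrable_of_continuous ((W.continuous_acceptFrom _ _).comp (hΓ.comp continuous_proj))

theorem abs_haarProb_id_sub_acceptProb_maxMixed_le :
    |W.haarProb id - W.acceptProb (maxMixed n)| ≤ (W.copies : ℝ) ^ 2 / 2 ^ n := by
  have hmixed : W.compl.acceptProb (maxMixed n) = 1 - W.acceptProb (maxMixed n) :=
    W.acceptFrom_compl (isDensityMatrix_maxMixed n).trace_eq_one _ _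
  have hhaar : W.compl.haarProb id = 1 - W.haarProb id := by
    have hψ (ψ : PureState n) : W.compl.acceptProb (id (proj ψ)) = 1 - W.acceptProb (id (proj ψ)) :=
      W.acceptFrom_compl (isDensityMatrix_proj ψ).trace_eq_one _ _
    simp only [haarProb, hψ]
    rw [integral_sub (integrable_const _) (W.integrable_acceptProb continuous_id)]
    simp
  have hlower := W.acceptProb_maxMixed_sub_le_haarProb_id
  have hupper := W.compl.acceptProb_maxMixed_sub_le_haarProb_id
  rw [hmixed, hhaar] at hupper
  change _ - (W.copies : ℝ) ^ 2 / 2 ^ n ≤ _ at hupper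
  rw [abs_le]
  constructor <;> linarith

end MemorylessAlgorithm

/-! ### Noise -/

section Kraus

variable {ι κ : Type*} [Fintype ι] [Fintype κ] (E : κ → Matrix ι ι ℂ)

/-- The adjoint, with respect to the trace pairing, of the map with Kraus operators `E`: noise on
the state is moved to the effect that measures it. -/
def krausAdjoint (M : Matrix ι ι ℂ) : Matrix ι ι ℂ :=
  ∑ i, (E i).conjTranspose * M * E i

theorem posSemidef_krausAdjoint {M : Matrix ι ι ℂ} (hM : M.PosSemidef) :
    (krausAdjoint E M).PosSemidef :=
  Matrix.posSemidef_sum _ fun i _ => hM.conjTranspose_mul_mul_same (E i)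

theorem krausAdjoint_sum {o : Type*} (s : Finset o) (M : o → Matrix ι ι ℂ) :
    krausAdjoint E (∑ j ∈ s, M j) = ∑ j ∈ s, krausAdjoint E (M j) := by
  simp only [krausAdjoint, Finset.mul_sum, Finset.sum_mul]
  exact Finset.sum_comm

theorem trace_krausAdjoint_mul (M ρ : Matrix ι ι ℂ) :
    (krausAdjoint E M * ρ).trace = (M * ∑ i, E i * ρ * (E i).conjTranspose).trace := by
  simp only [krausAdjoint, Finset.sum_mul, Finset.mul_sum, Matrix.trace_sum]
  refine Finset.sum_congr rfl fun i _ => ?_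
  rw [Matrix.mul_assoc, Matrix.mul_assoc, Matrix.trace_mul_comm]
  simp only [Matrix.mul_assoc]

end Kraus

section Channels

variable {n : ℕ} {Γ : QMat n → QMat n}

theorem IsChannel.continuous (hΓ : IsChannel Γ) : Continuous Γ := by
  obtain ⟨r, E, -, hE⟩ := hΓ
  rw [funext hE]
  exact continuous_finsetSum _ fun i _ =>
    (continuous_const.matrix_mul continuous_id).matrix_mul continuous_const

theorem IsChannel.isDensityMatrix (hΓ : IsChannel Γ) {ρ : QMat n} (hρ : IsDensityMatrix ρ) :
    IsDensityMatrix (Γ ρ) := by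
  obtain ⟨r, E, hE₁, hE⟩ := hΓ
  rw [hE]
  refine ⟨Matrix.posSemidef_sum _ fun i _ => hρ.posSemidef.mul_mul_conjTranspose_same (E i), ?_⟩
  have htrace := trace_krausAdjoint_mul E 1 ρ
  simpa only [krausAdjoint, mul_one, one_mul, hE₁, hρ.trace_eq_one, eq_comm] using htrace

theorem IsUnitalChannel.apply_maxMixed (hΓ : IsUnitalChannel Γ) :
    Γ (maxMixed n) = maxMixed n := by
  obtain ⟨⟨r, E, -, hE⟩, hone⟩ := hΓ
  rw [hE] at hone ⊢
  simp only [maxMixed, Matrix.mul_smul, Matrix.smul_mul, ← Finset.smul_sum, hone]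

end Channels

namespace MemorylessAlgorithm

variable {n : ℕ} (W : MemorylessAlgorithm n)

/-- The algorithm that sends every copy through the channel with Kraus operators `E` before it is
measured. -/
def withNoise {κ : Type*} [Fintype κ] (E : κ → QMat n)
    (hE : ∑ i, (E i).conjTranspose * E i = 1) : MemorylessAlgorithm n where
  copies := W.copies
  Out := W.Out
  povm h o := krausAdjoint E (W.povm h o)
  posSemidef h o := posSemidef_krausAdjoint E (W.posSemidef h o)
  sum_eq_one h := by
    rw [← krausAdjoint_sum, W.sum_eq_one]
    simpa only [krausAdjoint, mul_one] using hE
  accept := W.accept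

theorem acceptFrom_withNoise {κ : Type*} [Fintype κ] (E : κ → QMat n)
    (hE : ∑ i, (E i).conjTranspose * E i = 1) (ρ : QMat n) (t : ℕ) (h : List W.Out) :
    (W.withNoise E hE).acceptFrom ρ t h =
      W.acceptFrom (∑ i, E i * ρ * (E i).conjTranspose) t h := by
  induction t generalizing h with
  | zero => rfl
  | succ t ih =>
    exact Finset.sum_congr rfl fun o _ => congrArg₂ (· * ·)
      (congrArg Complex.re (trace_krausAdjoint_mul E (W.povm h o) ρ)) (ih (o :: h))

theorem acceptProb_withNoise {κ : Type*} [Fintype κ] (E : κ → QMat n)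
    (hE : ∑ i, (E i).conjTranspose * E i = 1) (ρ : QMat n) :
    (W.withNoise E hE).acceptProb ρ = W.acceptProb (∑ i, E i * ρ * (E i).conjTranspose) :=
  W.acceptFrom_withNoise E hE ρ _ _

theorem exists_withNoise {Γ : QMat n → QMat n} (hΓ : IsChannel Γ) :
    ∃ V : MemorylessAlgorithm n, V.copies = W.copies ∧
      ∀ ρ, V.acceptProb ρ = W.acceptProb (Γ ρ) := by
  obtain ⟨r, E, hE₁, hE⟩ := hΓ
  refine ⟨W.withNoise E hE₁, rfl, fun ρ => ?_⟩
  rw [hE, acceptProb_withNoise]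

theorem abs_haarProb_sub_acceptProb_maxMixed_le {Γ : QMat n → QMat n} (hΓ : IsUnitalChannel Γ) :
    |W.haarProb Γ - W.acceptProb (maxMixed n)| ≤ (W.copies : ℝ) ^ 2 / 2 ^ n := by
  obtain ⟨V, hV, hVΓ⟩ := W.exists_withNoise hΓ.1
  have hle := V.abs_haarProb_id_sub_acceptProb_maxMixed_le
  rw [hV, hVΓ, hΓ.apply_maxMixed] at hle
  simpa only [haarProb, hVΓ, id] using hle

theorem abs_haarProb_sub_haarProb_id_le {Γ : QMat n → QMat n} (hΓ : IsUnitalChannel Γ) :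
    |W.haarProb Γ - W.haarProb id| ≤ 2 * ((W.copies : ℝ) ^ 2 / 2 ^ n) := by
  have hΓmixed := W.abs_haarProb_sub_acceptProb_maxMixed_le hΓ
  have hidmixed := W.abs_haarProb_id_sub_acceptProb_maxMixed_le
  rw [abs_sub_comm] at hidmixed
  linarith [abs_sub_le (W.haarProb Γ) (W.acceptProb (maxMixed n)) (W.haarProb id)]

end MemorylessAlgorithm

/-! ### Approximate noise -/

theorem TraceClose.nonneg {n : ℕ} {ε : ℝ} {A B : QMat n} (hAB : TraceClose ε A B) : 0 ≤ ε := by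
  simpa using hAB 0 Matrix.PosSemidef.zero (by simpa using Matrix.PosSemidef.one)

theorem TraceClose.abs_sum_mul_sub_le {n : ℕ} {ε : ℝ} {A B : QMat n} (hAB : TraceClose ε A B)
    {ι : Type*} [Fintype ι] {M : ι → QMat n} (hM : ∀ i, (M i).PosSemidef) (hM₁ : ∑ i, M i = 1)
    {c : ι → ℝ} (hc : ∀ i, c i ∈ Set.Icc (0 : ℝ) 1) :
    |∑ i, c i * ((M i * A).trace.re - (M i * B).trace.re)| ≤ ε := by
  have hE : (∑ i, (c i : ℂ) • M i).PosSemidef :=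
    Matrix.posSemidef_sum _ fun i _ => (hM i).smul (by exact_mod_cast (hc i).1)
  have hE' : (1 - ∑ i, (c i : ℂ) • M i).PosSemidef := by
    have hsub : 1 - ∑ i, (c i : ℂ) • M i = ∑ i, ((1 - c i : ℝ) : ℂ) • M i := by
      push_cast
      simp only [sub_smul, one_smul, Finset.sum_sub_distrib, hM₁]
    rw [hsub]
    exact Matrix.posSemidef_sum _ fun i _ => (hM i).smul (by exact_mod_cast sub_nonneg.2 (hc i).2)
  have htrace : ((∑ i, (c i : ℂ) • M i) * (A - B)).trace.re =
      ∑ i, c i * ((M i * A).trace.re - (M i * B).trace.re) := by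
    simp only [Finset.sum_mul, Matrix.trace_sum, Complex.re_sum, Matrix.smul_mul,
      Matrix.trace_smul, smul_eq_mul, Complex.re_ofReal_mul, mul_sub, Matrix.trace_sub,
      Complex.sub_re, Finset.sum_sub_distrib]
  rw [← htrace]
  exact (Complex.abs_re_le_norm _).trans (hAB _ hE hE')

namespace MemorylessAlgorithm

variable {n : ℕ} (W : MemorylessAlgorithm n)

theorem abs_acceptFrom_sub_le {ε : ℝ} {A B : QMat n} (hAB : TraceClose ε A B)
    (hA : IsDensityMatrix A) (hB : IsDensityMatrix B) (t : ℕ) (h : List W.Out) :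
    |W.acceptFrom A t h - W.acceptFrom B t h| ≤ t * ε := by
  induction t generalizing h with
  | zero => simp [acceptFrom]
  | succ t ih =>
    have hfirst : |∑ o, W.acceptFrom B t (o :: h) *
        ((W.povm h o * A).trace.re - (W.povm h o * B).trace.re)| ≤ ε :=
      hAB.abs_sum_mul_sub_le (W.posSemidef h) (W.sum_eq_one h)
        fun o => W.acceptFrom_mem_Icc hB t (o :: h)
    have hlater : |∑ o, (W.povm h o * A).trace.re *
        (W.acceptFrom A t (o :: h) - W.acceptFrom B t (o :: h))| ≤ t * ε := by
      have hp (o) := re_trace_mul_nonneg (W.posSemidef h o) hA.posSemidef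
      calc |∑ o, (W.povm h o * A).trace.re *
            (W.acceptFrom A t (o :: h) - W.acceptFrom B t (o :: h))|
          ≤ ∑ o, (W.povm h o * A).trace.re *
            |W.acceptFrom A t (o :: h) - W.acceptFrom B t (o :: h)| := by
            refine (Finset.abs_sum_le_sum_abs _ _).trans_eq (Finset.sum_congr rfl fun o _ => ?_)
            rw [abs_mul, abs_of_nonneg (hp o)]
        _ ≤ ∑ o, (W.povm h o * A).trace.re * (t * ε) :=
            Finset.sum_le_sum fun o _ => mul_le_mul_of_nonneg_left (ih _) (hp o)
        _ = t * ε := by rw [← Finset.sum_mul, W.sum_re_trace_povm_mul h hA.trace_eq_one, one_mul]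
    have hsplit : W.acceptFrom A (t + 1) h - W.acceptFrom B (t + 1) h =
        ∑ o, (W.povm h o * A).trace.re *
          (W.acceptFrom A t (o :: h) - W.acceptFrom B t (o :: h)) +
        ∑ o, W.acceptFrom B t (o :: h) *
          ((W.povm h o * A).trace.re - (W.povm h o * B).trace.re) := by
      simp only [acceptFrom]
      rw [← Finset.sum_sub_distrib, ← Finset.sum_add_distrib]
      exact Finset.sum_congr rfl fun o _ => by ring
    rw [hsplit]
    push_cast
    linarith [abs_add_le (∑ o, (W.povm h o * A).trace.re *
      (W.acceptFrom A t (o :: h) - W.acceptFrom B t (o :: h)))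
      (∑ o, W.acceptFrom B t (o :: h) * ((W.povm h o * A).trace.re - (W.povm h o * B).trace.re))]

theorem abs_acceptProb_sub_le {ε : ℝ} {Γ Γ' : QMat n → QMat n} (hΓ : IsChannel Γ)
    (hΓ' : IsChannel Γ') {ψ : PureState n} (h : TraceClose ε (Γ (proj ψ)) (Γ' (proj ψ))) :
    |W.acceptProb (Γ (proj ψ)) - W.acceptProb (Γ' (proj ψ))| ≤ W.copies * ε :=
  W.abs_acceptFrom_sub_le h (hΓ.isDensityMatrix (isDensityMatrix_proj ψ))
    (hΓ'.isDensityMatrix (isDensityMatrix_proj ψ)) _ _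

theorem abs_haarProb_sub_haarProb_le {ε : ℝ} {Γ Γ' : QMat n → QMat n} (hΓ : IsChannel Γ)
    (hΓ' : IsChannel Γ') (h : ∀ ψ : PureState n, TraceClose ε (Γ (proj ψ)) (Γ' (proj ψ))) :
    |W.haarProb Γ - W.haarProb Γ'| ≤ W.copies * ε := by
  rw [haarProb, haarProb, ← integral_sub (W.integrable_acceptProb hΓ.continuous)
    (W.integrable_acceptProb hΓ'.continuous)]
  have hψ (ψ : PureState n) :
      ‖W.acceptProb (Γ (proj ψ)) - W.acceptProb (Γ' (proj ψ))‖ ≤ W.copies * ε :=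
    W.abs_acceptProb_sub_le hΓ hΓ' (h ψ)
  simpa using norm_integral_le_of_norm_le_const (ae_of_all (haar n) hψ)

theorem abs_keyProb_sub_keyProb_le {ε : ℝ} {Γ Γ' : QMat n → QMat n} (hΓ : IsChannel Γ)
    (hΓ' : IsChannel Γ') (h : ∀ ψ : PureState n, TraceClose ε (Γ (proj ψ)) (Γ' (proj ψ)))
    {K : Type} [Fintype K] [Nonempty K] (φ : K → PureState n) :
    |W.keyProb φ Γ - W.keyProb φ Γ'| ≤ W.copies * ε := by
  have hK : (0 : ℝ) < Fintype.card K := by exact_mod_cast Fintype.card_pos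
  rw [keyProb, keyProb, ← mul_sub, ← Finset.sum_sub_distrib, abs_mul, abs_of_pos (inv_pos.2 hK),
    inv_mul_le_iff₀ hK]
  calc |∑ k, (W.acceptProb (Γ (proj (φ k))) - W.acceptProb (Γ' (proj (φ k))))|
      ≤ ∑ k, |W.acceptProb (Γ (proj (φ k))) - W.acceptProb (Γ' (proj (φ k)))| :=
        Finset.abs_sum_le_sum_abs _ _
    _ ≤ ∑ _ : K, W.copies * ε :=
        Finset.sum_le_sum fun k _ => W.abs_acceptProb_sub_le hΓ hΓ' (h (φ k))
    _ = Fintype.card K * (W.copies * ε) := by rw [Finset.sum_const, Finset.card_univ, nsmul_eq_mul]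

theorem abs_keyProb_sub_haarProb_id_le {ε : ℝ} {Γ Γ' : QMat n → QMat n} (hΓ : IsUnitalChannel Γ)
    (hΓ' : IsChannel Γ') (h : ∀ ψ : PureState n, TraceClose ε (Γ (proj ψ)) (Γ' (proj ψ)))
    {K : Type} [Fintype K] [Nonempty K] (φ : K → PureState n) :
    |W.keyProb φ Γ - W.haarProb id| ≤
      |W.keyProb φ Γ' - W.haarProb Γ'| + 2 * (W.copies * ε) + 2 * (W.copies ^ 2 / 2 ^ n) := by
  have hkey := W.abs_keyProb_sub_keyProb_le hΓ.1 hΓ' h φ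
  have hhaar := W.abs_haarProb_sub_haarProb_le hΓ.1 hΓ' h
  have hnoise := W.abs_haarProb_sub_haarProb_id_le hΓ
  rw [abs_sub_comm] at hhaar
  linarith [abs_sub_le (W.keyProb φ Γ) (W.keyProb φ Γ') (W.haarProb id),
    abs_sub_le (W.keyProb φ Γ') (W.haarProb Γ') (W.haarProb id),
    abs_sub_le (W.haarProb Γ') (W.haarProb Γ) (W.haarProb id)]

end MemorylessAlgorithm

/-! ### Copy complexity -/

theorem mul_sqrt_mul_two_rpow_le {n T : ℕ} {c ε : ℝ} (hc : 0 ≤ c)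
    (hε : c ^ 2 * ε ≤ (T : ℝ) ^ 2 / 2 ^ n) :
    c * Real.sqrt ε * (2 : ℝ) ^ ((n : ℝ) / 2) ≤ T := by
  have hpow : (2 : ℝ) ^ ((n : ℝ) / 2) = Real.sqrt (2 ^ n) := by
    rw [Real.sqrt_eq_rpow, ← Real.rpow_natCast, ← Real.rpow_mul two_pos.le, mul_one_div]
  calc c * Real.sqrt ε * (2 : ℝ) ^ ((n : ℝ) / 2)
      = Real.sqrt (c ^ 2 * ε * 2 ^ n) := by
        rw [hpow, Real.sqrt_mul' _ (by positivity), Real.sqrt_mul (sq_nonneg c), Real.sqrt_sq hc]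
    _ ≤ Real.sqrt ((T : ℝ) ^ 2) := Real.sqrt_le_sqrt ((le_div_iff₀ (by positivity)).1 hε)
    _ = T := Real.sqrt_sq T.cast_nonneg

namespace MemorylessAlgorithm

variable {n : ℕ} (W : MemorylessAlgorithm n) {Γ : QMat n → QMat n} {ε : ℝ}

theorem half_mul_sqrt_mul_le_copies_of_maxMixed (hΓ : IsUnitalChannel Γ)
    (hε : ε ≤ |W.haarProb Γ - W.acceptProb (maxMixed n)|) :
    1 / 2 * Real.sqrt ε * (2 : ℝ) ^ ((n : ℝ) / 2) ≤ W.copies := by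
  refine mul_sqrt_mul_two_rpow_le (by norm_num) ?_
  have hcopies : (0 : ℝ) ≤ (W.copies : ℝ) ^ 2 / 2 ^ n := by positivity
  linarith [hε.trans (W.abs_haarProb_sub_acceptProb_maxMixed_le hΓ)]

theorem half_mul_sqrt_mul_le_copies_of_haar (hΓ : IsUnitalChannel Γ)
    (hε : ε ≤ |W.haarProb Γ - W.haarProb id|) :
    1 / 2 * Real.sqrt ε * (2 : ℝ) ^ ((n : ℝ) / 2) ≤ W.copies := by
  refine mul_sqrt_mul_two_rpow_le (by norm_num) ?_
  have hcopies : (0 : ℝ) ≤ (W.copies : ℝ) ^ 2 / 2 ^ n := by positivity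
  linarith [hε.trans (W.abs_haarProb_sub_haarProb_id_le hΓ)]

theorem half_mul_sqrt_mul_le_copies_of_key {K : Type} [Fintype K] {φ : K → PureState n} {δ : ℝ}
    (hφ : ∀ V : MemorylessAlgorithm n, V.copies = W.copies →
      |V.keyProb φ id - V.haarProb id| ≤ δ)
    (hΓ : IsUnitalChannel Γ) (hε : δ + ε ≤ |W.keyProb φ Γ - W.haarProb id|) :
    1 / 2 * Real.sqrt ε * (2 : ℝ) ^ ((n : ℝ) / 2) ≤ W.copies := by
  obtain ⟨V, hV, hVΓ⟩ := W.exists_withNoise hΓ.1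
  have hnoisy : |W.keyProb φ Γ - W.haarProb Γ| ≤ δ := by
    simpa only [keyProb, haarProb, hVΓ, id] using hφ V hV
  refine W.half_mul_sqrt_mul_le_copies_of_haar hΓ ?_
  linarith [abs_sub_le (W.keyProb φ Γ) (W.haarProb Γ) (W.haarProb id)]

end MemorylessAlgorithm

/-! ### Circuits with idle qubits -/

theorem extend_update {Q R β : Type*} [DecidableEq Q] [DecidableEq R] {f : Q → R}
    (hf : f.Injective) (z : Q → β) (b : R → β) (w : Q) (a : β) :
    Function.update (Function.extend f z b) (f w) a =
      Function.extend f (Function.update z w a) b := by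
  funext v
  by_cases hv : ∃ q, f q = v
  · obtain ⟨q, rfl⟩ := hv
    simp only [Function.update_apply, hf.extend_apply, hf.eq_iff]
  · rw [Function.extend_apply' _ _ _ hv, Function.update_of_ne fun h => hv ⟨w, h.symm⟩,
      Function.extend_apply' _ _ _ hv]

theorem mem_range_extend_iff {Q R β : Type*} {f : Q → R} (hf : f.Injective) {b x : R → β} :
    x ∈ Set.range (fun z : Q → β => Function.extend f z b) ↔ ∀ v ∉ Set.range f, x v = b v := by
  refine ⟨?_, fun hx => ⟨x ∘ f, funext fun v => ?_⟩⟩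
  · rintro ⟨z, rfl⟩ v hv
    exact Function.extend_apply' _ _ _ hv
  · by_cases hv : v ∈ Set.range f
    · obtain ⟨q, rfl⟩ := hv
      exact hf.extend_apply _ _ _
    · exact (Function.extend_apply' _ _ _ hv).trans (hx v hv).symm

section Pad

variable {Q R S : Type} [Fintype Q] [DecidableEq Q] [Fintype R]

/-- The matrix of the map that places the register `Q` in `R` by means of `f` and sets the qubits
outside the range of `f` to the bits `b`. -/
def padMatrix (f : Q → R) (b : R → Bool) : Matrix (R → Bool) (Q → Bool) ℂ :=
  fun x z => if x = Function.extend f z b then 1 else 0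

/-- The state `σ` of the register `Q`, placed in `R` by means of `f`, together with idle qubits
outside the range of `f` in the computational basis state `b`. -/
def padState (f : Q → R) (b : R → Bool) (σ : Op Q) : Op R :=
  padMatrix f b * σ * (padMatrix f b).conjTranspose

theorem padState_extend {f : Q → R} (hf : f.Injective) (b : R → Bool) (σ : Op Q)
    (z z' : Q → Bool) :
    padState f b σ (Function.extend f z b) (Function.extend f z' b) = σ z z' := by
  simp [padState, padMatrix, Matrix.mul_apply, (Function.extend_injective hf b).eq_iff]

theorem padState_eq_zero {f : Q → R} {b : R → Bool} (σ : Op Q) {x y : R → Bool}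
    (hxy : ¬(x ∈ Set.range (fun z : Q → Bool => Function.extend f z b) ∧
      y ∈ Set.range (fun z : Q → Bool => Function.extend f z b))) :
    padState f b σ x y = 0 := by
  have hzero {x} (hx : x ∉ Set.range (fun z : Q → Bool => Function.extend f z b))
      (z : Q → Bool) : padMatrix f b x z = 0 := if_neg fun h => hx ⟨z, h.symm⟩
  rw [padState, Matrix.mul_apply]
  rcases not_and_or.1 hxy with hx | hy
  · simp only [Matrix.mul_apply, hzero hx, zero_mul, Finset.sum_const_zero]
  · simp only [Matrix.conjTranspose_apply, hzero hy, star_zero, mul_zero, Finset.sum_const_zero]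

theorem padState_padState [DecidableEq R] [Fintype S] {f : Q → R} (hf : f.Injective) {g : R → S}
    (hg : g.Injective) (b : S → Bool) (σ : Op Q) :
    padState g b (padState f (b ∘ g) σ) = padState (g ∘ f) b σ := by
  have hmul : padMatrix g b * padMatrix f (b ∘ g) = padMatrix (g ∘ f) b := by
    ext x z
    simp [Matrix.mul_apply, padMatrix, hf.extend_comp hg]
  rw [padState, padState, padState, ← hmul, Matrix.conjTranspose_mul]
  simp only [Matrix.mul_assoc]

theorem onQubit_apply_eq_sum (w : Q) (u : Matrix Bool Bool ℂ) (x y : Q → Bool) :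
    onQubit w u x y = ∑ a, if x = Function.update y w a then u a (y w) else 0 := by
  have hupdate (a : Bool) : x = Function.update y w a ↔ x w = a ∧ ∀ v, v ≠ w → x v = y v :=
    Function.eq_update_iff
  simp only [hupdate, ite_and, Finset.sum_ite_eq, Finset.mem_univ, if_true, onQubit]

variable [DecidableEq R]

theorem onQubit_mul_padMatrix {f : Q → R} (hf : f.Injective) (b : R → Bool) (w : Q)
    (u : Matrix Bool Bool ℂ) :
    onQubit (f w) u * padMatrix f b = padMatrix f b * onQubit w u := by
  ext x z
  have hentry : (onQubit (f w) u * padMatrix f b) x z =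
      onQubit (f w) u x (Function.extend f z b) := by
    simp [Matrix.mul_apply, padMatrix]
  rw [hentry, onQubit_apply_eq_sum, Matrix.mul_apply]
  simp only [onQubit_apply_eq_sum, Finset.mul_sum]
  rw [Finset.sum_comm]
  refine Finset.sum_congr rfl fun a _ => ?_
  simp [padMatrix, hf.extend_apply, extend_update hf]

theorem cnotMatrix_mul_padMatrix {f : Q → R} (hf : f.Injective) (b : R → Bool) (c w : Q) :
    cnotMatrix (f c) (f w) * padMatrix f b = padMatrix f b * cnotMatrix c w := by
  ext x z
  simp [Matrix.mul_apply, padMatrix, cnotMatrix, hf.extend_apply, extend_update hf]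

theorem conj_padState {f : Q → R} {b : R → Bool} {A : Op R} {B : Op Q}
    (hAB : A * padMatrix f b = padMatrix f b * B) (σ : Op Q) :
    A * padState f b σ * A.conjTranspose = padState f b (B * σ * B.conjTranspose) := by
  have hstar := congrArg Matrix.conjTranspose hAB
  rw [Matrix.conjTranspose_mul, Matrix.conjTranspose_mul] at hstar
  calc A * padState f b σ * A.conjTranspose
      = (A * padMatrix f b) * σ * ((padMatrix f b).conjTranspose * A.conjTranspose) := by
        simp only [padState, Matrix.mul_assoc]
    _ = padState f b (B * σ * B.conjTranspose) := by
        rw [hAB, hstar]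
        simp only [padState, Matrix.mul_assoc]

end Pad

/-- Renaming of the qubits on which a gate acts. -/
def Gate.map {Q R : Type} (f : Q → R) : Gate Q → Gate R
  | .had w => .had (f w)
  | .tee w => .tee (f w)
  | .cnot c w => .cnot (f c) (f w)
  | .reset w => .reset (f w)

theorem Gate.apply_padState {Q R : Type} [Fintype Q] [DecidableEq Q] [Fintype R] [DecidableEq R]
    {f : Q → R} (hf : f.Injective) (b : R → Bool) (g : Gate Q) (σ : Op Q) :
    (g.map f).apply (padState f b σ) = padState f b (g.apply σ) := by
  cases g with
  | had w => exact conj_padState (onQubit_mul_padMatrix hf b w _) σ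
  | tee w => exact conj_padState (onQubit_mul_padMatrix hf b w _) σ
  | cnot c w => exact conj_padState (cnotMatrix_mul_padMatrix hf b c w) σ
  | reset w =>
    rw [Gate.map, Gate.apply,
      Finset.sum_congr rfl fun i _ => conj_padState (onQubit_mul_padMatrix hf b w _) σ]
    simp only [Gate.apply, padState, Matrix.mul_sum, Matrix.sum_mul]

/-- The inclusion of a register in a register with more classical bits and ancillas. -/
def Reg.castLE (n : ℕ) {s s' a a' : ℕ} (hs : s ≤ s') (ha : a ≤ a') : Reg n s a → Reg n s' a' :=
  Sum.map id (Sum.map (Fin.castLE hs) (Fin.castLE ha))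

/-- The bits `m` in the register of classical bits, and zeros elsewhere. -/
def registerBits (n a : ℕ) {s : ℕ} (m : Fin s → Bool) : Reg n s a → Bool :=
  Sum.elim (fun _ => false) (Sum.elim m fun _ => false)

theorem prepare_eq_padState {n s : ℕ} (a : ℕ) (ρ : QMat n) (m : Fin s → Bool) :
    prepare a ρ m = padState Sum.inl (registerBits n a m) ρ := by
  have hrange (x : Reg n s a → Bool) :
      x ∈ Set.range (fun z => Function.extend Sum.inl z (registerBits n a m)) ↔
        (∀ i, x (.inr (.inl i)) = m i) ∧ (∀ i, x (.inr (.inr i)) = false) := by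
    rw [mem_range_extend_iff Sum.inl_injective]
    simp [registerBits]
  ext x y
  by_cases hxy : x ∈ Set.range (fun z => Function.extend Sum.inl z (registerBits n a m)) ∧
    y ∈ Set.range (fun z => Function.extend Sum.inl z (registerBits n a m))
  · rw [prepare, if_pos (by rwa [hrange, hrange] at hxy)]
    obtain ⟨⟨z, rfl⟩, ⟨z', rfl⟩⟩ := hxy
    simp only [padState_extend Sum.inl_injective, Sum.inl_injective.extend_apply]
  · rw [padState_eq_zero _ hxy, prepare, if_neg (by rwa [hrange, hrange] at hxy)]

section EnlargedRegister

variable {n s s' a a' : ℕ} (hs : s ≤ s') (ha : a ≤ a')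

theorem Reg.castLE_injective : (Reg.castLE n hs ha).Injective :=
  Function.injective_id.sumMap ((Fin.castLE_injective hs).sumMap (Fin.castLE_injective ha))

theorem registerBits_comp_castLE (m : Fin s' → Bool) :
    registerBits n a' m ∘ Reg.castLE n hs ha = registerBits n a (m ∘ Fin.castLE hs) := by
  funext v
  rcases v with v | v | v <;> rfl

theorem padState_castLE_prepare (ρ : QMat n) (m : Fin s' → Bool) :
    padState (Reg.castLE n hs ha) (registerBits n a' m) (prepare a ρ (m ∘ Fin.castLE hs)) =
      prepare a' ρ m := by
  rw [prepare_eq_padState, prepare_eq_padState, ← registerBits_comp_castLE hs ha,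
    padState_padState Sum.inl_injective (Reg.castLE_injective hs ha)]
  rfl

theorem Wire.locate_castLE {w : Wire} {r : Reg n s a} (hw : w.locate n s a = some r) :
    w.locate n s' a' = some (Reg.castLE n hs ha r) := by
  cases w <;>
    simp only [Wire.locate, Option.dite_none_right_eq_some, Option.some.injEq] at hw ⊢ <;>
    obtain ⟨hi, rfl⟩ := hw
  · exact ⟨hi, rfl⟩
  · exact ⟨hi.trans_le hs, rfl⟩
  · exact ⟨hi.trans_le ha, rfl⟩

theorem Gate.locate_castLE {g : Gate Wire} {g' : Gate (Reg n s a)}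
    (hg : g.locate n s a = some g') :
    g.locate n s' a' = some (g'.map (Reg.castLE n hs ha)) := by
  cases g with
  | had w | tee w | reset w =>
    obtain ⟨r, hr, rfl⟩ := Option.map_eq_some_iff.1 hg
    simp only [Gate.locate, Wire.locate_castLE hs ha hr, Option.map_some, Gate.map]
  | cnot c w =>
    obtain ⟨q, hq, hw⟩ := Option.bind_eq_some_iff.1 hg
    obtain ⟨r, hr, rfl⟩ := Option.map_eq_some_iff.1 hw
    simp only [Gate.locate, Wire.locate_castLE hs ha hr, Wire.locate_castLE hs ha hq,
      Option.map_some, Option.bind_some, Gate.map]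

theorem Circuit.run_cons {C : Circuit} {g : Gate Wire} {g' : Gate (Reg n s a)}
    (hg : g.locate n s a = some g') (σ : Op (Reg n s a)) :
    Circuit.run (g :: C) n s a σ = C.run n s a (g'.apply σ) := by
  simp only [Circuit.run, List.filterMap_cons_some hg, List.foldl_cons]

theorem Circuit.run_padState {C : Circuit} (hC : C.Valid n s a) (b : Reg n s' a' → Bool)
    (σ : Op (Reg n s a)) :
    C.run n s' a' (padState (Reg.castLE n hs ha) b σ) =
      padState (Reg.castLE n hs ha) b (C.run n s a σ) := by
  induction C generalizing σ with
  | nil => rfl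
  | cons g C ih =>
    obtain ⟨⟨-, hsome⟩, hC⟩ := List.forall_mem_cons.1 hC
    obtain ⟨g', hg'⟩ := Option.isSome_iff_exists.1 hsome
    rw [Circuit.run_cons hg', Circuit.run_cons (Gate.locate_castLE hs ha hg'),
      Gate.apply_padState (Reg.castLE_injective hs ha), ih hC]

theorem readProb_padState (b : Reg n s a' → Bool) (σ : Op (Reg n s a)) (m : Fin s → Bool) :
    readProb (padState (Reg.castLE n le_rfl ha) b σ) m = readProb σ m := by
  have hf : (Reg.castLE n le_rfl ha).Injective := Reg.castLE_injective (le_refl s) ha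
  refine (Fintype.sum_of_injective _ (Function.extend_injective hf b) _ _
    (fun x hx => ?_) fun z => ?_).symm
  · rw [padState_eq_zero _ fun h => hx h.1, ite_self]
  · have hbit (i : Fin s) : Function.extend (Reg.castLE n le_rfl ha) z b (.inr (.inl i)) =
        z (.inr (.inl i)) := hf.extend_apply z b (.inr (.inl i))
    simp only [hbit, padState_extend hf]

end EnlargedRegister

theorem Circuit.Valid.mono {n s s' a a' : ℕ} {C : Circuit} (hC : C.Valid n s a) (hs : s ≤ s')
    (ha : a ≤ a') : C.Valid n s' a' := by
  intro g hg
  obtain ⟨hproper, hsome⟩ := hC g hg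
  obtain ⟨g', hg'⟩ := Option.isSome_iff_exists.1 hsome
  exact ⟨hproper, Option.isSome_iff_exists.2 ⟨_, Gate.locate_castLE hs ha hg'⟩⟩

/-! ### Noisy copies and efficient adversaries -/

theorem Circuit.run_append (C D : Circuit) (n s a : ℕ) (σ : Op (Reg n s a)) :
    Circuit.run (C ++ D) n s a σ = D.run n s a (C.run n s a σ) := by
  simp only [Circuit.run, List.filterMap_append, List.foldl_append]

theorem Circuit.run_prepare_of_channel {n s a a' : ℕ} (ha : a ≤ a') {D : Circuit}
    (hD : D.Valid n 0 a) {Γ : QMat n → QMat n}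
    (hΓ : ∀ ρ, D.run n 0 a (prepare a ρ Fin.elim0) = prepare a (Γ ρ) Fin.elim0)
    (ρ : QMat n) (m : Fin s → Bool) :
    D.run n s a' (prepare a' ρ m) = prepare a' (Γ ρ) m := by
  have hbits : m ∘ Fin.castLE s.zero_le = Fin.elim0 := Subsingleton.elim _ _
  rw [← padState_castLE_prepare s.zero_le ha, Circuit.run_padState _ _ hD, hbits, hΓ, ← hbits,
    padState_castLE_prepare]

theorem Circuit.readProb_run_prepare_of_le {n s a a' : ℕ} (ha : a ≤ a') {C : Circuit}
    (hC : C.Valid n s a) (ρ : QMat n) (m o : Fin s → Bool) :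
    readProb (C.run n s a' (prepare a' ρ m)) o = readProb (C.run n s a (prepare a ρ m)) o := by
  rw [← padState_castLE_prepare le_rfl ha, Circuit.run_padState _ _ hC, readProb_padState]
  rfl

/-- The noise starts on fresh ancillas and returns them in `|0⟩`, so the measurement circuit can
reuse them. -/
theorem IsQPT.withNoise {W : ∀ n, MemorylessAlgorithm n} (hW : IsQPT W) {D : ℕ → Circuit}
    {a : Polynomial ℕ} (hDu : Uniform D) (hD : ∀ n, (D n).Valid n 0 (a.eval n)) {r : ℕ → ℕ}
    (E : ∀ n, Fin (r n) → QMat n) (hE : ∀ n, ∑ i, (E n i).conjTranspose * E n i = 1)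
    (hrun : ∀ n ρ, (D n).run n 0 (a.eval n) (prepare (a.eval n) ρ Fin.elim0) =
      prepare (a.eval n) (∑ i, E n i * ρ * (E n i).conjTranspose) Fin.elim0) :
    IsQPT fun n => (W n).withNoise (E n) (hE n) := by
  obtain ⟨C, T, s, a', hCu, hC, hCW⟩ := hW
  refine ⟨fun n => D n ++ C n, T, s, a + a', Uniform.append D C hDu hCu, fun n => ?_, fun n => ?_⟩
  · rw [Polynomial.eval_add]
    exact List.forall_mem_append.2 ⟨(hD n).mono (Nat.zero_le _) (Nat.le_add_right _ _),
      (hC n).mono le_rfl (Nat.le_add_left _ _)⟩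
  · obtain ⟨hT, e, hpovm, haccept⟩ := hCW n
    refine ⟨hT, e, fun h o ρ => ?_, haccept⟩
    rw [Polynomial.eval_add, Circuit.run_append,
      Circuit.run_prepare_of_channel (Nat.le_add_right _ _) (hD n) (hrun n),
      Circuit.readProb_run_prepare_of_le (Nat.le_add_left _ _) (hC n)]
    exact (trace_krausAdjoint_mul (E n) ((W n).povm h o) ρ).trans (hpovm h o _)

/-! ### Negligible functions -/

open Asymptotics Filter Polynomial

theorem negligible_iff_superpolynomialDecay {f : ℕ → ℝ} (hf : ∀ n, 0 ≤ f n) :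
    Negligible f ↔ SuperpolynomialDecay atTop (fun n : ℕ => (n : ℝ)) f := by
  refine ⟨fun h => ?_, fun h c => ?_⟩
  · refine (superpolynomialDecay_iff_abs_isBoundedUnder f tendsto_natCast_atTop_atTop).2
      fun c => ?_
    obtain ⟨n₀, hn₀⟩ := h c
    refine isBoundedUnder_of_eventually_le (a := 1) ((eventually_gt_atTop n₀).mono fun n hn => ?_)
    rw [abs_of_nonneg (mul_nonneg (by positivity) (hf n))]
    exact (mul_le_mul_of_nonneg_left (hn₀ n hn).le (by positivity)).trans mul_inv_le_one
  · obtain ⟨n₀, hn₀⟩ := eventually_atTop.1 ((h c).eventually_lt_const one_pos)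
    refine ⟨n₀, fun n hn => ?_⟩
    have hpos : (0 : ℝ) < n := by exact_mod_cast (Nat.zero_le _).trans_lt hn
    rw [inv_eq_one_div, lt_div_iff₀' (by positivity)]
    exact hn₀ n hn.le

theorem superpolynomialDecay_eval_mul {f : ℕ → ℝ}
    (hf : SuperpolynomialDecay atTop (fun n : ℕ => (n : ℝ)) f) (p : ℕ[X]) :
    SuperpolynomialDecay atTop (fun n : ℕ => (n : ℝ)) fun n => (p.eval n : ℕ) * f n := by
  simpa only [eval_natCast_map, eq_natCast, Nat.cast_id] using
    hf.polynomial_mul (p.map (Nat.castRingHom ℝ))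

theorem superpolynomialDecay_inv_const_pow {r : ℝ} (hr : 1 < r) :
    SuperpolynomialDecay atTop (fun n : ℕ => (n : ℝ)) fun n => (r ^ n)⁻¹ :=
  fun c => tendsto_pow_const_div_const_pow_of_one_lt c hr

theorem negligible_abs_keyProb_sub_haarProb {K : ℕ → Type} [∀ n, Fintype (K n)]
    [∀ n, Nonempty (K n)] {φ : ∀ n, K n → PureState n}
    (hφ : ∀ W : ∀ n, MemorylessAlgorithm n, IsQPT W →
      Negligible fun n => |(W n).keyProb (φ n) id - (W n).haarProb id|)
    {Γ : ∀ n, QMat n → QMat n} (hΓ : ∀ n, IsUnitalChannel (Γ n)) (hΓe : IsEfficientNoise Γ)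
    {W : ∀ n, MemorylessAlgorithm n} (hW : IsQPT W) :
    Negligible fun n => |(W n).keyProb (φ n) (Γ n) - (W n).haarProb id| := by
  obtain ⟨D, a, Γ', ε, hDu, hD, hΓ', hε, hrun, hclose⟩ := hΓe
  have hnoisy : Negligible fun n => |(W n).keyProb (φ n) (Γ' n) - (W n).haarProb (Γ' n)| := by
    choose r E hE₁ hE using hΓ'
    simp only [hE] at hrun
    simpa only [MemorylessAlgorithm.keyProb, MemorylessAlgorithm.haarProb,
      MemorylessAlgorithm.acceptProb_withNoise, ← hE, id] using
      hφ _ (hW.withNoise hDu hD E hE₁ hrun)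
  obtain ⟨_, T, _, _, _, _, hT⟩ := hW
  have hcopies (n : ℕ) : (W n).copies = T.eval n := (hT n).1
  have hε₀ (n : ℕ) : 0 ≤ ε n := (hclose n (φ n (Classical.arbitrary _))).nonneg
  rw [negligible_iff_superpolynomialDecay fun _ => abs_nonneg _] at hnoisy ⊢
  rw [negligible_iff_superpolynomialDecay hε₀] at hε
  have hinv := superpolynomialDecay_inv_const_pow one_lt_two
  refine ((hnoisy.add ((superpolynomialDecay_eval_mul hε T).const_mul 2)).add
    ((superpolynomialDecay_eval_mul hinv (T ^ 2)).const_mul 2)).trans_abs_le fun n => ?_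
  rw [abs_abs]
  refine le_trans ?_ (le_abs_self _)
  simpa only [Pi.add_apply, hcopies, eval_pow, Nat.cast_pow, div_eq_mul_inv] using
    (W n).abs_keyProb_sub_haarProb_id_le (hΓ n) (hΓ' n) (hclose n) (φ n)

end

end MemorylessPRS

theorem mainTheorem8_general :
    (∀ (n : ℕ) (Γ : QMat n → QMat n), IsUnitalChannel Γ →
      ∀ (W : MemorylessAlgorithm n) (ε : ℝ), 0 < ε →
        (ε ≤ |W.haarProb Γ - W.acceptProb (maxMixed n)| →
          1 / 2 * Real.sqrt ε * (2 : ℝ) ^ ((n : ℝ) / 2) ≤ (W.copies : ℝ)) ∧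
        (ε ≤ |W.haarProb Γ - W.haarProb id| →
          1 / 2 * Real.sqrt ε * (2 : ℝ) ^ ((n : ℝ) / 2) ≤ (W.copies : ℝ))) ∧
    (∀ (n : ℕ) (Γ : QMat n → QMat n), IsUnitalChannel Γ →
      ∀ (K : Type) [Fintype K] [Nonempty K] (φ : K → PureState n) (T : ℕ) (δ : ℝ),
        (∀ V : MemorylessAlgorithm n, V.copies = T → |V.keyProb φ id - V.haarProb id| ≤ δ) →
        ∀ W : MemorylessAlgorithm n, W.copies = T → ∀ ε : ℝ, 0 < ε →
          δ + ε ≤ |W.keyProb φ Γ - W.haarProb id| →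
            1 / 2 * Real.sqrt ε * (2 : ℝ) ^ ((n : ℝ) / 2) ≤ (T : ℝ)) ∧
    (∀ (K : ℕ → Type) [∀ n, Fintype (K n)] [∀ n, Nonempty (K n)] (φ : ∀ n, K n → PureState n),
      (∀ W : ∀ n, MemorylessAlgorithm n, IsQPT W →
        Negligible fun n => |(W n).keyProb (φ n) id - (W n).haarProb id|) →
      ∀ Γ : ∀ n, QMat n → QMat n, (∀ n, IsUnitalChannel (Γ n)) → IsEfficientNoise Γ →
      ∀ W : ∀ n, MemorylessAlgorithm n, IsQPT W →
        Negligible fun n => |(W n).keyProb (φ n) (Γ n) - (W n).haarProb id|) := by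
  refine ⟨fun n Γ hΓ W ε _ => ⟨W.half_mul_sqrt_mul_le_copies_of_maxMixed hΓ,
    W.half_mul_sqrt_mul_le_copies_of_haar hΓ⟩, ?_, ?_⟩
  · rintro n Γ hΓ K _ _ φ T δ hφ W rfl ε -
    exact W.half_mul_sqrt_mul_le_copies_of_key hφ hΓ
  · intro K _ _ φ hφ Γ hΓ hΓe W hW
    exact negligible_abs_keyProb_sub_haarProb hφ hΓ hΓe hW

theorem mainTheorem8 :
    -- any unital noise, any adversary without quantum memory: `Ω(2^(n/2))` copies are needed to
    -- distinguish noisy Haar random states from the maximally mixed state, and noisy Haar random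
    -- states from Haar random states
    (∃ c : ℝ, 0 < c ∧ ∀ (n : ℕ) (Γ : QMat n → QMat n), IsUnitalChannel Γ →
      ∀ (W : MemorylessAlgorithm n) (ε : ℝ), 0 < ε →
        (ε ≤ |W.haarProb Γ - W.acceptProb (maxMixed n)| →
          c * Real.sqrt ε * (2 : ℝ) ^ ((n : ℝ) / 2) ≤ (W.copies : ℝ)) ∧
        (ε ≤ |W.haarProb Γ - W.haarProb id| →
          c * Real.sqrt ε * (2 : ℝ) ^ ((n : ℝ) / 2) ≤ (W.copies : ℝ))) ∧
    -- any unital noise, any adversary without quantum memory: noise on a family of pseudorandom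
    -- states gains an additional advantage `ε` only from `Ω(2^(n/2))` copies
    (∃ c : ℝ, 0 < c ∧ ∀ (n : ℕ) (Γ : QMat n → QMat n), IsUnitalChannel Γ →
      ∀ (K : Type) [Fintype K] [Nonempty K] (φ : K → PureState n) (T : ℕ) (δ : ℝ),
        (∀ V : MemorylessAlgorithm n, V.copies = T → |V.keyProb φ id - V.haarProb id| ≤ δ) →
        ∀ W : MemorylessAlgorithm n, W.copies = T → ∀ ε : ℝ, 0 < ε →
          δ + ε ≤ |W.keyProb φ Γ - W.haarProb id| →
            c * Real.sqrt ε * (2 : ℝ) ^ ((n : ℝ) / 2) ≤ (T : ℝ)) ∧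
    -- efficient unital noise, efficient adversaries without quantum memory: noisy memoryless PRS
    -- are not distinguished from Haar random states with polynomially many copies
    (∀ (κ : Polynomial ℕ) (φ : ∀ n, (Fin (κ.eval n) → Bool) → PureState n),
      IsMemorylessPRS κ φ →
      ∀ Γ : ∀ n, QMat n → QMat n, (∀ n, IsUnitalChannel (Γ n)) → IsEfficientNoise Γ →
      ∀ W : ∀ n, MemorylessAlgorithm n, IsQPT W →
        Negligible fun n => |(W n).keyProb (φ n) (Γ n) - (W n).haarProb id|) := by
  obtain ⟨hhaar, hkey, hprs⟩ := mainTheorem8_general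
  exact ⟨⟨1 / 2, by norm_num, hhaar⟩, ⟨1 / 2, by norm_num, hkey⟩,
    fun _ φ hφ => hprs _ φ hφ.indistinguishable⟩
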